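/- Let $\mathbb{F}_r$ be a finite field with $r$ elements and characteristic $p$, let $A=\mathbb{F}_r[\theta]$, and let $K_\infty=\mathbb{F}_r((1/\theta))$ be the completion of $\mathbb{F}_r(\theta)$ at infinity, with normalized valuation $v_\infty$. Let $\pi\in K_\infty$ be a uniformizer. Every $\alpha\in K_\infty^\times$ can be written uniquely as $\alpha=\zeta\,\pi^{k}\,\langle\alpha\rangle_\pi$ with $\zeta$ a root of unity in $K_\infty$, $k\in\mathbb{Z}$ and $\langle\alpha\rangle_\pi$ a $1$-unit; for a nonzero ideal $\mathfrak{a}\subseteq A$ put $\langle\mathfrak{a}\rangle_\pi=\langle\alpha\rangle_\pi$ for any generator $\alpha$ of $\mathfrak{a}$, and $\deg\mathfrak{a}=\dim_{\mathbb{F}_r}A/\mathfrak{a}$. For $y\in\mathbb{Z}_p$ let $$\zeta_{\mathbb{F}_r[\theta],\pi}(x,y)=\sum_{0\ne\mathfrak{a}\subseteq A}x^{\deg\mathfrak{a}}\,\langle\mathfrak{a}\rangle_\pi^{\,y}=\sum_{n\ge 0}\Bigl(\sum_{\deg\mathfrak{a}=n}\langle\mathfrak{a}\rangle_\pi^{\,y}\Bigr)x^n\in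 K_\infty[[x]]$$ be the $\pi$-adic Goss zeta function of $A$, regarded as a power series in $x$. Then for every $y\in\mathbb{Z}_p$, every (finite) slope of the $\pi$-adic Newton polygon of $\zeta_{\mathbb{F}_r[\theta],\pi}(x,y)$, that is, of the lower convex hull of the points $(n,v_\infty(c_n))$ with $c_n$ the coefficient of $x^n$, occurs with multiplicity one (horizontal length $1$) and is an integer multiple of $r-1$. -/

import Mathlib

namespace GossZeta

open Polynomial WithZero Filter Topology

variable {F : Type*} [Field F]

/-- `K_∞ = F((1/θ))`, the completion of `F(θ)` at infinity. -/
abbrev KInfty (F : Type*) [Field F] : Type _ :=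
  @RatFunc.CompletionAtInfty F _ (Classical.decEq _)

/-- The normalized additive valuation `v_∞` of `K_∞`, with values in `ℤ ∪ {∞}`; a uniformizer has
valuation `1`, and `v_∞(0) = ∞`.
(Mathlib's `Valued.v` is the multiplicative version `exp (-v_∞)`.) -/
noncomputable def ord (x : KInfty F) : EReal :=
  open scoped Classical in
  if x = 0 then ⊤ else (((-log (Valued.v x) : ℤ) : ℝ) : EReal)

/-- `π` is a uniformizer of `K_∞`, that is, `v_∞(π) = 1`. -/
def IsUniformizer (π : KInfty F) : Prop :=
  Valued.v π = (exp (-1 : ℤ) : ℤᵐ⁰)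

/-- `u` belongs to the group `U_∞` of `1`-units of `K_∞`. -/
def IsOneUnit (u : KInfty F) : Prop :=
  Valued.v (u - 1) < (1 : ℤᵐ⁰)

/-- `u` is the `1`-unit component of `α` in `K_∞ˣ = μ_∞ × π^ℤ × U_∞`, where `μ_∞` is the
group of roots of unity of `K_∞`. -/
def IsOneUnitPart (π α u : KInfty F) : Prop :=
  IsOneUnit u ∧ ∃ ζ : KInfty F, (∃ m : ℕ, 0 < m ∧ ζ ^ m = 1) ∧
    ∃ k : ℤ, α = ζ * π ^ k * u

/-- The `1`-unit `⟨α⟩_π` of a nonzero `α ∈ K_∞`; it only depends on the class of `α` in the group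
`K_∞ˣ / μ_∞` of positive numbers. -/
noncomputable def oneUnitPart (π α : KInfty F) :
    KInfty F :=
  open scoped Classical in
  if h : ∃ u, IsOneUnitPart π α u then h.choose else 1

/-- `⟨𝔞⟩_π` for a nonzero ideal `𝔞` of `F[θ]`: the `1`-unit of any generator of `𝔞`. -/
noncomputable def idealOneUnit (π : KInfty F) (𝔞 : Ideal F[X]) :
    KInfty F :=
  oneUnitPart π (algebraMap (RatFunc F) (KInfty F)
    (algebraMap F[X] (RatFunc F) (Submodule.IsPrincipal.generator 𝔞)))

/-- The power `u ^ y` of a `1`-unit `u` by a `p`-adic integer `y`: the limit of the powers `u ^ m`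
along the natural numbers `m = y mod p ^ n`, `n → ∞`. -/
noncomputable def padicPow {p : ℕ} [Fact p.Prime] (u : KInfty F) (y : ℤ_[p]) :
    KInfty F :=
  limUnder atTop fun n : ℕ => u ^ y.appr n

/-- The nonzero ideals of `F[θ]` of degree `n`, where `deg 𝔞 = dim_F F[θ]/𝔞`. -/
def idealsOfDegree (F : Type*) [Field F] (n : ℕ) : Set (Ideal F[X]) :=
  {𝔞 | 𝔞 ≠ ⊥ ∧ Module.finrank F (F[X] ⧸ 𝔞) = n}

/-- The Goss zeta function `ζ_{A,π}(x, y) = ∑_𝔞 x ^ deg 𝔞 ⟨𝔞⟩_π ^ y` of `A = F[θ]`, summed over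
the nonzero ideals of `A`, as a power series in `x` with coefficients in `K_∞`. -/
noncomputable def zeta {p : ℕ} [Fact p.Prime] (π : KInfty F) (y : ℤ_[p]) :
    PowerSeries (KInfty F) :=
  PowerSeries.mk fun n => ∑ᶠ 𝔞 ∈ idealsOfDegree F n, padicPow (idealOneUnit π 𝔞) y

/-- The Newton polygon of a power series `∑ c_k x^k` over `K_∞`, evaluated at the abscissa `n`: the
lower convex hull of the points `(k, v_∞(c_k))`, i.e. the supremum of all affine functions whose
graph lies on or below all these points. -/
noncomputable def newtonPolygon (f : PowerSeries (KInfty F)) (n : ℕ) : EReal :=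
  ⨆ (l : ℝ × ℝ) (_ : ∀ k : ℕ, ((l.1 * k + l.2 : ℝ) : EReal) ≤ ord (PowerSeries.coeff k f)),
    ((l.1 * n + l.2 : ℝ) : EReal)

/-- The multiplicity of `s` as a slope of the Newton polygon: the horizontal length of the part of
slope `s`. As the vertices have integral abscissae, this is the number of `n` such that the polygon
is finite of slope `s` on `[n, n + 1]`. -/
noncomputable def slopeMultiplicity (f : PowerSeries (KInfty F)) (s : ℝ) : ℕ∞ :=
  {n : ℕ | ∃ a : ℝ, newtonPolygon f n = (a : EReal) ∧
    newtonPolygon f (n + 1) = ((a + s : ℝ) : EReal)}.encard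

/-- `s` is a (finite) slope of the Newton polygon of `f`. -/
def IsSlope (f : PowerSeries (KInfty F)) (s : ℝ) : Prop :=
  slopeMultiplicity f s ≠ 0

/-! Well-definedness of the objects above. -/

theorem v_ratFunc (x : RatFunc F) : (Valued.v (algebraMap (RatFunc F) (KInfty F) x) : ℤᵐ⁰) =
   letI := Classical.decEq (RatFunc F); RatFunc.inftyValuation F x := by
  let := Classical.decEq (RatFunc F)
  let := RatFunc.inftyValued F
  exact Valued.extensionValuation_apply_coe (K := RatFunc F) x

theorem charP_KInfty (p : ℕ) [CharP F p] : CharP (KInfty F) p := by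
  have : CharP (RatFunc F) p := charP_of_injective_algebraMap (algebraMap F (RatFunc F)).injective p
  exact charP_of_injective_algebraMap (algebraMap (RatFunc F) (KInfty F)).injective p

theorem completeSpace_KInfty : CompleteSpace (KInfty F) := by
  let := Classical.decEq (RatFunc F)
  let := RatFunc.inftyValued F
  exact inferInstanceAs (CompleteSpace (UniformSpace.Completion (RatFunc F)))

theorem IsOneUnit.v_eq {u : KInfty F} (hu : IsOneUnit u) : Valued.v u = (1 : ℤᵐ⁰) := by
  have := Valuation.map_add_eq_of_lt_right (Valued.v (R := KInfty F)) (x := u - 1) (y := 1)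
    (by rw [map_one]; exact hu)
  simpa using this

theorem IsOneUnit.pow {u : KInfty F} (hu : IsOneUnit u) (k : ℕ) :
   (Valued.v (u^k - 1) : ℤᵐ⁰) ≤ Valued.v (u - 1) := by
  have h := mul_geom_sum u k
  rw [← h, map_mul]
  refine mul_le_of_le_one_right' ?_
  refine Valuation.map_sum_le _ fun i _ => ?_
  simp [hu.v_eq]

theorem exists_ratFunc (x : KInfty F) : ∃ r : RatFunc F,
    Valued.v (algebraMap (RatFunc F) (KInfty F) r - x) < (1 : ℤᵐ⁰) := by
  let := Classical.decEq (RatFunc F)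
  let := RatFunc.inftyValued F
  have hd : DenseRange (algebraMap (RatFunc F) (KInfty F)) :=
    UniformSpace.Completion.denseRange_coe (α := RatFunc F)
  have hn : {y : KInfty F | Valued.v (y - x) < (1 : ℤᵐ⁰)} ∈ 𝓝 x := by
    rw [Valued.mem_nhds]
    refine ⟨1, fun y hy => ?_⟩
    simpa using hy
  obtain ⟨r, hr⟩ := hd.exists_mem_open isOpen_interior ⟨x, mem_interior_iff_mem_nhds.2 hn⟩
  exact ⟨r, (interior_subset hr : algebraMap (RatFunc F) (KInfty F) r ∈ {y : KInfty F | Valued.v (y - x) < (1 : ℤᵐ⁰)})⟩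

/-- The limit defining `u ^ y` exists for every `1`-unit `u`. -/
theorem tendsto_padicPow {p : ℕ} [Fact p.Prime] [CharP F p] {u : KInfty F} (hu : IsOneUnit u)
    (y : ℤ_[p]) : Tendsto (fun n : ℕ => u ^ y.appr n) atTop (𝓝 (padicPow u y)) := by
  have := charP_KInfty (F := F) p
  have := completeSpace_KInfty (F := F)
  have : ExpChar (KInfty F) p := ExpChar.prime Fact.out
  apply tendsto_nhds_limUnder
  apply cauchySeq_tendsto_of_complete
  have key : ∀ m n, m ≤ n → (Valued.v (u ^ y.appr n - u ^ y.appr m) : ℤᵐ⁰) ≤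
      Valued.v (u - 1) ^ p ^ m := by
    intro m n h
    obtain ⟨k, hk⟩ := y.dvd_appr_sub_appr m n h
    have h2 := y.appr_mono h
    have : y.appr n = y.appr m + p ^ m * k := by omega
    rw [this, pow_add, ← mul_sub_one, mul_comm (p^m) k, pow_mul u k, map_mul, map_pow, hu.v_eq, one_pow, one_mul]
    have : (u ^ k) ^ p ^ m - 1 = (u ^ k - 1) ^ p ^ m := by
      rw [sub_pow_expChar_pow, one_pow]
    rw [this, map_pow]
    exact pow_le_pow_left₀ zero_le (hu.pow k) _
  rw [CauchySeq, Valued.cauchy_iff]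
  refine ⟨inferInstance, fun γ => ?_⟩
  set g : ℤᵐ⁰ := MonoidWithZeroHom.ValueGroup₀.embedding γ.val with hg
  have hg0 : g ≠ 0 := MonoidWithZeroHom.ValueGroup₀.embedding_unit_ne_zero γ
  obtain ⟨N, hN⟩ : ∃ N : ℕ, (Valued.v (u - 1) : ℤᵐ⁰) ^ N < g := by
    exact exists_pow_lt₀ hu (Units.mk0 g hg0)
  refine ⟨(fun n : ℕ => u ^ y.appr n) '' Set.Ici N, image_mem_map (Ici_mem_atTop N), ?_⟩
  have h3 : ∀ m n, N ≤ m → m ≤ n → (Valued.v (u ^ y.appr n - u ^ y.appr m) : ℤᵐ⁰) < g := by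
    intro m n hm hmn
    refine (key m n hmn).trans_lt (lt_of_le_of_lt ?_ hN)
    refine pow_le_pow_of_le_one zero_le hu.le (hm.trans (Nat.lt_pow_self (Fact.out : p.Prime).one_lt).le)
  rintro _ ⟨m, hm, rfl⟩ _ ⟨n, hn, rfl⟩
  rw [Valuation.restrict_lt_iff_lt_embedding]
  rcases le_total m n with h | h
  · exact h3 m n hm h
  · rw [Valuation.map_sub_swap]; exact h3 n m hn h

theorem root_eq_one (p : ℕ) [Fact p.Prime] [CharP F p] {u : KInfty F} (hu : IsOneUnit u) {m : ℕ}
    (hm : 0 < m) (h : u ^ m = 1) : u = 1 := by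
  have := charP_KInfty (F := F) p
  obtain ⟨k, m', hpm, rfl⟩ := Nat.exists_eq_pow_mul_and_not_dvd hm.ne' p (Fact.out : p.Prime).ne_one
  have : ExpChar (KInfty F) p := ExpChar.prime Fact.out
  rw [mul_comm, pow_mul] at h
  have h1 : u ^ m' = 1 := by
    rw [← sub_eq_zero] at h ⊢
    rw [← one_pow (p^k), ← sub_pow_expChar_pow] at h
    exact eq_zero_of_pow_eq_zero h
  rw [← sub_eq_zero, ← mul_geom_sum, mul_eq_zero] at h1
  rcases h1 with h1 | h1
  · exact sub_eq_zero.1 h1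
  · exfalso
    have h2 : (Valued.v (∑ i ∈ Finset.range m', (u ^ i - 1)) : ℤᵐ⁰) < 1 := 
      Valuation.map_sum_lt _ one_ne_zero fun i _ => (hu.pow i).trans_lt hu
    have h4 : (m' : KInfty F) ≠ 0 := by
      rw [Ne, CharP.cast_eq_zero_iff _ p]; exact hpm
    simp [Finset.sum_sub_distrib, h1, Valuation.map_neg] at h2
    have h5 : (m' : KInfty F) = algebraMap (RatFunc F) (KInfty F) (RatFunc.C (m' : F)) := by simp
    have h6 : (m' : F) ≠ 0 := by intro h0; apply h4; rw [h5, h0]; simp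
    let := Classical.decEq (RatFunc F)
    rw [h5, v_ratFunc, RatFunc.inftyValuation.C _ h6] at h2
    exact lt_irrefl _ h2

theorem v_const {c : F} (hc : c ≠ 0) :
    (Valued.v (algebraMap (RatFunc F) (KInfty F) (RatFunc.C c)) : ℤᵐ⁰) = 1 := by
  let := Classical.decEq (RatFunc F)
  rw [v_ratFunc, RatFunc.inftyValuation.C _ hc]

theorem v_poly {f : F[X]} (hf : f ≠ 0) :
    (Valued.v (algebraMap (RatFunc F) (KInfty F) (algebraMap F[X] (RatFunc F) f)) : ℤᵐ⁰) =
      exp (f.natDegree : ℤ) := by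
  let := Classical.decEq (RatFunc F)
  rw [v_ratFunc, RatFunc.inftyValuation_apply, RatFunc.inftyValuation.polynomial _ hf]

theorem exists_const (r : RatFunc F)
    (hr : (Valued.v (algebraMap (RatFunc F) (KInfty F) r) : ℤᵐ⁰) = 1) :
    ∃ c : F, c ≠ 0 ∧
      Valued.v (algebraMap (RatFunc F) (KInfty F) (RatFunc.C c - r)) < (1 : ℤᵐ⁰) := by
  have hr0 : r ≠ 0 := by rintro rfl; simp at hr
  have hn := RatFunc.num_ne_zero hr0
  have hd := RatFunc.denom_ne_zero r
  have e := RatFunc.num_div_denom r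
  have hdeg : r.num.natDegree = r.denom.natDegree := by
    rw [← e, map_div₀, map_div₀, v_poly hn, v_poly hd, ← exp_sub, exp_eq_one] at hr
    omega
  refine ⟨r.num.leadingCoeff, leadingCoeff_ne_zero.2 hn, ?_⟩
  have e2 : RatFunc.C r.num.leadingCoeff - r = algebraMap F[X] (RatFunc F)
      (C r.num.leadingCoeff * r.denom - r.num) / algebraMap F[X] (RatFunc F) r.denom := by
    have hd' : algebraMap F[X] (RatFunc F) r.denom ≠ 0 := RatFunc.algebraMap_ne_zero hd
    rw [map_sub, map_mul, RatFunc.algebraMap_C, sub_div, e]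
    field_simp
  rw [e2, map_div₀, map_div₀, v_poly hd]
  by_cases h0 : C r.num.leadingCoeff * r.denom - r.num = 0
  · rw [h0]; simp
  · rw [v_poly h0, ← exp_sub, ← exp_zero, exp_lt_exp]
    have hlt : (C r.num.leadingCoeff * r.denom - r.num).degree <
        (C r.num.leadingCoeff * r.denom).degree := by
      have hl := leadingCoeff_ne_zero.2 hn
      apply degree_sub_lt_left
      · rw [degree_C_mul hl, degree_eq_natDegree hn, degree_eq_natDegree hd, hdeg]
      · exact mul_ne_zero (C_ne_zero.2 hl) hd
      · rw [leadingCoeff_mul, leadingCoeff_C, (RatFunc.monic_denom r).leadingCoeff, mul_one]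
    have := natDegree_lt_natDegree h0 hlt
    rw [natDegree_C_mul (leadingCoeff_ne_zero.2 hn)] at this
    omega

/-- Every nonzero element of `K_∞` has exactly one `1`-unit component. -/
theorem existsUnique_oneUnitPart (p : ℕ) [Fact p.Prime] [CharP F p] [Finite F] {π α : KInfty F}
    (hπ : IsUniformizer π) (hα : α ≠ 0) : ∃! u, IsOneUnitPart π α u := by
  have hπ0 : π ≠ 0 := by 
    rintro rfl
    rw [IsUniformizer, map_zero] at hπ
    exact exp_ne_zero hπ.symm
  have hv1 : ∀ {ζ : KInfty F} {m : ℕ}, 0 < m → ζ ^ m = 1 → (Valued.v ζ : ℤᵐ⁰) = 1 := by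
    intro ζ m hm h
    have h2 := congrArg (Valued.v : Valuation (KInfty F) ℤᵐ⁰) h
    rw [map_pow, map_one] at h2
    simpa [hm.ne'] using h2
  apply existsUnique_of_exists_of_unique
  · set k : ℤ := -log (Valued.v α : ℤᵐ⁰) with hk
    have hw : (Valued.v (α * π ^ (-k)) : ℤᵐ⁰) = 1 := by
      rw [map_mul, map_zpow₀, hπ, hk, neg_neg, ← exp_zsmul]
      simp [hα]
    obtain ⟨r, hr⟩ := exists_ratFunc (α * π ^ (-k))
    have hr1 : (Valued.v (algebraMap (RatFunc F) (KInfty F) r) : ℤᵐ⁰) = 1 := by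
      rw [Valuation.map_eq_of_sub_lt _ (by rwa [hw]), hw]
    obtain ⟨c, hc, hcr⟩ := exists_const r hr1
    set c' := algebraMap (RatFunc F) (KInfty F) (RatFunc.C c) with hc'
    have hvc : (Valued.v c' : ℤᵐ⁰) = 1 := v_const hc
    have hc0 : c' ≠ 0 := by rw [← Valuation.ne_zero_iff (Valued.v : Valuation (KInfty F) ℤᵐ⁰), hvc]; simp
    have hlt : (Valued.v (c' - α * π ^ (-k)) : ℤᵐ⁰) < 1 := by
      have : c' - α * π ^ (-k) = algebraMap (RatFunc F) (KInfty F) (RatFunc.C c - r) +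
          (algebraMap (RatFunc F) (KInfty F) r - α * π ^ (-k)) := by rw [map_sub]; ring
      rw [this]
      exact Valuation.map_add_lt _ hcr hr
    refine ⟨α * π ^ (-k) / c', ?_, c', ⟨Nat.card Fˣ, Nat.card_pos, ?_⟩, k, ?_⟩
    · have : α * π ^ (-k) / c' - 1 = -(c' - α * π ^ (-k)) / c' := by field_simp; ring
      rw [IsOneUnit, this, map_div₀, hvc, div_one, Valuation.map_neg]
      exact hlt
    · rw [hc', ← map_pow, ← map_pow]
      have : c ^ Nat.card Fˣ = 1 := by
        have h3 : (Units.mk0 c hc) ^ Nat.card Fˣ = 1 := pow_card_eq_one'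
        have h4 := congrArg Units.val h3
        rwa [Units.val_pow_eq_pow_val, Units.val_mk0, Units.val_one] at h4
      rw [this]; simp
    · have := zpow_ne_zero k hπ0
      clear_value k
      rw [zpow_neg]; field_simp
  · rintro u u' ⟨hu, ζ, ⟨m, hm, hζ⟩, k, h⟩ ⟨hu', ζ', ⟨m', hm', hζ'⟩, k', h'⟩
    have hkk : k = k' := by
      have h2 := congrArg (Valued.v : Valuation (KInfty F) ℤᵐ⁰) (h.symm.trans h')
      simp only [map_mul, map_zpow₀, hv1 hm hζ, hv1 hm' hζ', hu.v_eq, hu'.v_eq, one_mul, mul_one] at h2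
      rw [hπ, ← exp_zsmul, ← exp_zsmul, exp_inj] at h2
      simpa using h2
    subst hkk
    have hz0 : ζ ≠ 0 := by rintro rfl; simp [hm.ne'] at hζ
    have hu0 : u' ≠ 0 := by rintro rfl; rw [h'] at hα; simp at hα
    have e : ζ * u = ζ' * u' := by
      have := h.symm.trans h'
      have hp := zpow_ne_zero k hπ0
      apply mul_right_cancel₀ hp
      linear_combination this
    have e2 : u / u' = ζ' / ζ := by field_simp; linear_combination e
    have h1 : u / u' = 1 := by
      refine root_eq_one p ?_ (m := m * m') (by positivity) ?_
      · have : u / u' - 1 = ((u - 1) - (u' - 1)) / u' := by field_simp; ring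
        rw [IsOneUnit, this, map_div₀, hu'.v_eq, div_one]
        exact Valuation.map_sub_lt _ hu hu'
      · rw [e2, div_pow, mul_comm m, pow_mul, hζ', mul_comm m', pow_mul, hζ]; simp
    field_simp at h1; exact h1

theorem finrank_quot {f : F[X]} : Module.finrank F (F[X] ⧸ Ideal.span {f}) = f.natDegree :=
  finrank_quotient_span_eq_natDegree

theorem idealsOfDegree_eq (n : ℕ) : idealsOfDegree F n =
    (fun f : F[X] => Ideal.span {f}) '' {f : F[X] | f.Monic ∧ f.natDegree = n} := by
  ext I
  constructor
  · rintro ⟨h0, hn⟩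
    set g := Submodule.IsPrincipal.generator I
    have hg : Ideal.span {g} = I := Ideal.span_singleton_generator I
    have hg0 : g ≠ 0 := by
      intro h; apply h0; rw [← hg, h]; simp
    rw [← hg, finrank_quot] at hn
    classical
    refine ⟨normalize g, ⟨monic_normalize hg0, ?_⟩, ?_⟩
    · rw [← hn]; exact natDegree_eq_of_degree_eq degree_normalize
    · show Ideal.span {normalize g} = I
      rw [← hg]; exact Ideal.span_singleton_eq_span_singleton.2 (normalize_associated g)
  · rintro ⟨f, ⟨hf, rfl⟩, rfl⟩
    exact ⟨by simpa using hf.ne_zero, finrank_quot⟩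

/-- There are finitely many ideals of each degree, so the sums defining `zeta` are finite. -/
theorem finite_idealsOfDegree [Finite F] (n : ℕ) : (idealsOfDegree F n).Finite := by
  rw [idealsOfDegree_eq]
  refine Set.Finite.image _ ?_
  refine Set.Finite.subset (s := (degreeLT F (n+1) : Set F[X])) ?_ ?_
  · have := (degreeLTEquiv F (n+1)).toEquiv.finite_iff.2 inferInstance
    exact Set.toFinite _
  · rintro f ⟨hf, rfl⟩
    simp only [SetLike.mem_coe, mem_degreeLT]
    exact (degree_le_natDegree).trans_lt (by exact_mod_cast Nat.lt_succ_self _)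

end GossZeta

/-! For a natural exponent `k`, the coefficient of `x ^ n` is, up to a `1`-unit, `θ ^ (-nk)` times
the sum `S_n(k)` of the `k`-th powers of the monic polynomials of degree `n`; its valuation is `n k
- deg S_n(k)`. Valuations are locally constant away from `0`, so a nonzero coefficient at `y` has
the valuation found at `y.appr N` for large `N`.

Writing a monic polynomial as `X g + c` expresses `S_{n+1}(k)` through the `X ^ t S_n(t)`. Only
those `t < k` survive that are digitwise below `k` in base `p` (Lucas) and congruent to `k` modulo
`r - 1` (power sums over the field). Hence `deg S_n(k)` is the largest sum `t_1 + ... + t_n` over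
chains `k > t_1 > ... > t_n` of such steps, provided that only one chain attains it: then nothing
cancels (`powerSum_cases`). The valuation is `∑ (k - t_i)`, a multiple of `r - 1`. There remain the
uniqueness of the maximal chain (`IsMaxChain.unique`) and the strict convexity in `n`
(`IsMaxChain.add_lt_two_mul`), which makes every slope have length one.

Both are combinatorial. Let `r = p ^ f`. A digit sequence represents a multiple of `p ^ f - 1`
exactly when its digit sums in the classes modulo `f` are `p E (l + 1) - E l` for an integer vector
`E` on `ZMod f`. The cheapest number belonging to `E` fills each class from the lowest digit up.
Maximal chains thus become strictly increasing families of positive vectors `E` of minimal total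
cost. The cost is convex in each digit sum, hence submodular for `⊓` and `⊔`.

Uniqueness rests on `IsOptimal.lt_or_eq_of_interlaced`. A cheaper replacement of a member of an
optimal family must be blocked by the next member; the accumulated saving stays bounded in terms of
the blocking digit, and is either repaid or carried on to the last member, which nothing blocks. For
convexity, optimal families of sizes `n` and `n + 2` are mixed by shifted `⊓` and `⊔` into two
families of size `n + 1`; equality would, by uniqueness, make the two mixtures coincide, which is
impossible. -/

namespace GossZeta

/-! ### Vectors of carries on the cycle `ZMod f`. -/

section Lattice

variable {f : ℕ} {p : ℤ}

/-- The vector of digit sums attached to a periodic sequence `E` of carries. -/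
def digitSum (p : ℤ) (E : ZMod f → ℤ) (l : ZMod f) : ℤ := p * E (l + 1) - E l

theorem ZMod.cyclic_induction {f : ℕ} [NeZero f] {P : ZMod f → Prop} {c : ZMod f} (h0 : P c)
    (h : ∀ l, P (l + 1) → P l) (l : ZMod f) : P l := by
  have key : ∀ s : ℕ, P (c - s) := by
    intro s
    induction s with
    | zero => simpa using h0
    | succ s ih =>
      apply h
      have : c - ((s + 1 : ℕ) : ZMod f) + 1 = c - s := by push_cast; ring
      rwa [this]
  have := key (c - l).val
  rwa [ZMod.natCast_zmod_val, sub_sub_cancel] at this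

theorem ZMod.cyclic_induction' {f : ℕ} [NeZero f] {P : ZMod f → Prop} {c : ZMod f} (h0 : P c)
    (h : ∀ l, P l → P (l + 1)) (l : ZMod f) : P l := by
  have key : ∀ s : ℕ, P (c + s) := by
    intro s
    induction s with
    | zero => simpa using h0
    | succ s ih =>
      have : c + ((s + 1 : ℕ) : ZMod f) = c + s + 1 := by push_cast; ring
      rw [this]; exact h _ ih
  have := key (l - c).val
  rwa [ZMod.natCast_zmod_val, add_sub_cancel] at this

/-- At an index `m` where `|w|` is largest, `w (m - 1) = p * w m` exceeds the maximum unless the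
maximum is `0`. -/
theorem eq_zero_of_digitSum_eq_zero [NeZero f] (hp : 2 ≤ p) {w : ZMod f → ℤ}
    (hw : ∀ l, digitSum p w l = 0) : w = 0 := by
  obtain ⟨m, hm⟩ := Finite.exists_max (fun l => |w l|)
  have h1 : ∀ l, w l = p * w (l + 1) := fun l => by have := hw l; unfold digitSum at this; linarith
  have h2 := h1 (m - 1)
  rw [sub_add_cancel] at h2
  have h3 := hm (m - 1)
  rw [h2, abs_mul, abs_of_nonneg (by omega : (0 : ℤ) ≤ p)] at h3
  have h4 : |w m| = 0 := by nlinarith [abs_nonneg (w m)]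
  ext l
  have := hm l
  simp only [h4] at this
  simpa using this

theorem digitSum_injective [NeZero f] (hp : 2 ≤ p) {a b : ZMod f → ℤ}
    (h : ∀ l, digitSum p a l = digitSum p b l) : a = b := by
  have := eq_zero_of_digitSum_eq_zero hp (w := a - b) (fun l => by
    have := h l; unfold digitSum at *; simp only [Pi.sub_apply]; linarith)
  exact sub_eq_zero.1 this

/-- Between `a ≤ b` there is an element obtained from `a` by giving up one unit of class `c`
and gaining units of the other classes, not more than `b` has. -/
theorem exists_exchange [NeZero f] (hp : 2 ≤ p) {a b : ZMod f → ℤ} {c : ZMod f} (hab : a ≤ b)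
    (hc : a c < b c)
    (hcb : digitSum p b c ≤ digitSum p a c + p - 2) :
    ∃ e, a ≤ e ∧ e ≤ b ∧ digitSum p e c = digitSum p a c - 1 ∧
      (∀ l, l ≠ c → digitSum p a l ≤ digitSum p e l ∧
        digitSum p e l ≤ max (digitSum p a l) (digitSum p b l)) ∧
      e c = a c + 1 ∧ ((∀ l, a l < b l) → a c + 1 < b c → ∀ l, e l < b l) := by
  classical
  set cap : ZMod f → ℤ := fun l => max (digitSum p a l) (digitSum p b l) with hcap
  set H : Set (ZMod f → ℤ) := {e | (a ≤ e ∧ e ≤ b) ∧ a c + 1 ≤ e c ∧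
    ∀ l, l ≠ c → digitSum p e l ≤ cap l} with hH
  have hfin : H.Finite := (Set.finite_Icc a b).subset fun e he => he.1
  have hne : H.Nonempty := ⟨b, ⟨hab, le_rfl⟩, by omega, fun l _ => le_max_right _ _⟩
  -- For a minimal candidate, lowering a coordinate breaks a constraint: the coordinate equals that
  -- of `a`, or is the unit forced at `c`, or its digit sum is at the cap.
  obtain ⟨e, ⟨⟨hae, heb⟩, hec, hecap⟩, hmin⟩ :=
    Set.exists_min_image H (fun e => ∑ l, e l) hfin hne
  have hlow : ∀ l, e l = a l ∨ (l = c ∧ e c = a c + 1) ∨ (l ≠ c ∧ digitSum p e l = cap l) := by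
    intro l
    by_contra! hcon
    obtain ⟨h1, h2, h3⟩ := hcon
    have h1' : a l < e l := lt_of_le_of_ne (hae l) (Ne.symm h1)
    set e' := Function.update e l (e l - 1) with he'
    have he'l : ∀ m, e' m = if m = l then e l - 1 else e m := by
      intro m; simp [he', Function.update_apply]
    have : e' ∈ H := by
      refine ⟨⟨fun m => ?_, fun m => ?_⟩, ?_, fun m hm => ?_⟩
      · show a m ≤ e' m
        rw [he'l]; split_ifs with h
        · subst h; omega
        · exact hae m
      · show e' m ≤ b m
        rw [he'l]; split_ifs with h
        · subst h; have : e m ≤ b m := heb m; omega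
        · exact heb m
      · rw [he'l]; split_ifs with h
        · subst h; have := h2 rfl; omega
        · exact hec
      · have hm' := hecap m hm
        unfold digitSum at hm' ⊢
        rw [he'l, he'l]
        by_cases hml : m = l
        · subst hml
          have h4 := h3 hm
          have h5 : digitSum p e m < cap m := lt_of_le_of_ne (hecap m hm) h4
          unfold digitSum at h5
          rw [if_pos rfl]
          split_ifs with h
          · rw [h] at h5; nlinarith
          · linarith
        · rw [if_neg hml]
          split_ifs with h
          · rw [h] at hm'; nlinarith
          · exact hm'
    have hlt := hmin e' this
    have : ∑ m, e' m = ∑ m, e m - 1 := by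
      rw [he', Finset.sum_update_of_mem (Finset.mem_univ l),
        ← Finset.add_sum_erase _ _ (Finset.mem_univ l), Finset.sdiff_singleton_eq_erase]
      ring
    omega
  have hbc : ∀ l, l ≠ c → digitSum p b l ≤ cap l := fun l _ => le_max_right _ _
  have hac : ∀ l, digitSum p a l ≤ cap l := fun l => le_max_left _ _
  have hec1 : e c = a c + 1 := by
    rcases hlow c with h | h | h
    · omega
    · exact h.2
    · exact absurd rfl h.1
  -- a nonzero excess forces the excess of the next coordinate
  have step : ∀ l, l ≠ c → e l ≠ a l →
      e (l + 1) ≠ a (l + 1) ∧ p * (b (l + 1) - e (l + 1)) ≤ b l - e l := by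
    intro l hl hne
    have h1 : digitSum p e l = cap l := by
      rcases hlow l with h | h | h
      · exact absurd h hne
      · exact absurd h.1 hl
      · exact h.2
    have h2 := hac l
    have h3 := hbc l hl
    have h4 := hae l
    unfold digitSum at h1 h2 h3
    constructor
    · intro h
      rw [h] at h1
      have : a l < e l := lt_of_le_of_ne h4 (Ne.symm hne)
      linarith
    · linarith
  -- Going back from `c` through coordinates in excess of `a`, the gap `b - e` is multiplied by at
  -- least `p` each time, so it never falls below its value at `c`.
  have hQ : ∀ l, e l = a l ∨ b c - a c - 1 ≤ b l - e l := by
    refine ZMod.cyclic_induction (c := c) (Or.inr (by omega)) fun l hl => ?_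
    by_cases hlc : l = c
    · subst hlc; right; omega
    by_cases hel : e l = a l
    · exact Or.inl hel
    · right
      obtain ⟨h1, h2⟩ := step l hlc hel
      have h3 := hl.resolve_left h1
      have h4 := heb (l + 1)
      nlinarith
  -- If the excess went all round the cycle, `D = b c - a c` would satisfy `p D ≤ D + p - 2`,
  -- impossible for `D ≥ 1`.
  have hc1 : e (c + 1) = a (c + 1) := by
    by_contra hne
    have h1 := (hQ (c + 1)).resolve_left hne
    have h2 : a (c + 1) < e (c + 1) := lt_of_le_of_ne (hae _) (Ne.symm hne)
    unfold digitSum at hcb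
    nlinarith
  refine ⟨e, hae, heb, ?_, fun l hl => ⟨?_, hecap l hl⟩, hec1, fun hlt hc2 l => ?_⟩
  · unfold digitSum; rw [hec1, hc1]; ring
  · rcases hlow l with h | h | h
    · unfold digitSum
      rw [h]
      have := hae (l + 1)
      nlinarith
    · exact absurd h.1 hl
    · rw [h.2]; exact hac l
  -- A contact of `e` with `b` would propagate forward to `c`, where `e c = a c + 1 < b c`.
  · by_contra hcon
    have hl0 : b l = e l := le_antisymm (not_lt.1 hcon) (heb l)
    have : ∀ m, b m = e m := by
      refine ZMod.cyclic_induction' (c := l) hl0 fun m hm => ?_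
      have hmc : m ≠ c := by rintro rfl; omega
      have h1 := (step m hmc (by have := hlt m; omega)).2
      have h2 := heb (m + 1)
      nlinarith
    have := this c
    omega

/-- The largest element with nonnegative digit sums below `E` and strictly below `b`: compared
with `E`, a class of which it has more units is one in which `E` touches `b`. -/
theorem exists_maximal_below [NeZero f] (hp : 2 ≤ p) {a E b : ZMod f → ℤ} (haE : a ≤ E)
    (hEb : E ≤ b) (hab : ∀ l, a l < b l) (hu : ∀ l, 0 ≤ digitSum p a l)
    (huE : ∀ l, 0 ≤ digitSum p E l) :
    ∃ g, a ≤ g ∧ g ≤ E ∧ (∀ l, g l < b l) ∧ (∀ l, 0 ≤ digitSum p g l) ∧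
      ∀ c, digitSum p E c < digitSum p g c → digitSum p g c = digitSum p E c + 1 ∧
        E c = b c ∧ digitSum p E c + p ≤ digitSum p b c := by
  classical
  set H : Set (ZMod f → ℤ) := {g | (a ≤ g ∧ g ≤ E) ∧ (∀ l, g l < b l) ∧
    ∀ l, 0 ≤ digitSum p g l} with hH
  have hfin : H.Finite := (Set.finite_Icc a E).subset fun e he => he.1
  have hne : H.Nonempty := ⟨a, ⟨le_rfl, haE⟩, hab, hu⟩
  obtain ⟨g, ⟨⟨hag, hgE⟩, hgb, hug⟩, hmax⟩ :=
    Set.exists_max_image H (fun e => ∑ l, e l) hfin hne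
  have hup : ∀ l, g l = E l ∨ g l + 1 = b l ∨ digitSum p g l = 0 := by
    intro l
    by_contra! hcon
    obtain ⟨h1, h2, h3⟩ := hcon
    have h1' : g l < E l := lt_of_le_of_ne (hgE l) h1
    have h2' : g l + 1 < b l := lt_of_le_of_ne (hgb l) h2
    have h3' : 0 < digitSum p g l := lt_of_le_of_ne (hug l) (Ne.symm h3)
    set e' := Function.update g l (g l + 1) with he'
    have he'l : ∀ m, e' m = if m = l then g l + 1 else g m := by
      intro m; simp [he', Function.update_apply]
    have : e' ∈ H := by
      refine ⟨⟨fun m => ?_, fun m => ?_⟩, fun m => ?_, fun m => ?_⟩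
      · show a m ≤ e' m
        rw [he'l]; split_ifs with h
        · subst h; have : a m ≤ g m := hag m; omega
        · exact hag m
      · show e' m ≤ E m
        rw [he'l]; split_ifs with h
        · subst h; omega
        · exact hgE m
      · rw [he'l]; split_ifs with h
        · subst h; exact h2'
        · exact hgb m
      · have hm' := hug m
        unfold digitSum at hm' h3' ⊢
        rw [he'l, he'l]
        by_cases hml : m = l
        · subst hml
          rw [if_pos rfl]
          split_ifs with h
          · rw [h] at h3'; nlinarith
          · linarith
        · rw [if_neg hml]
          split_ifs with h
          · rw [h] at hm'; nlinarith
          · exact hm'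
    have hlt := hmax e' this
    have : ∑ m, e' m = ∑ m, g m + 1 := by
      rw [he', Finset.sum_update_of_mem (Finset.mem_univ l),
        ← Finset.add_sum_erase _ _ (Finset.mem_univ l), Finset.sdiff_singleton_eq_erase]
      ring
    omega
  refine ⟨g, hag, hgE, hgb, hug, fun c hc => ?_⟩
  have h0 := huE c
  have h1 : g (c + 1) ≤ E (c + 1) := hgE (c + 1)
  have h2 := hgb (c + 1)
  have h3 : E c ≤ b c := hEb c
  have h4 : g c ≤ E c := hgE c
  unfold digitSum at *
  have h5 : E c - g c ≤ 1 := by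
    have h9 := hup c
    rcases h9 with h | h | h
    · omega
    · omega
    · omega
  have h6 : E (c + 1) = g (c + 1) := by
    by_contra hne
    have : g (c + 1) + 1 ≤ E (c + 1) := by omega
    nlinarith
  have h7 : E c = g c + 1 := by rw [h6] at hc; omega
  have h8 : E c = b c := by
    rcases hup c with h | h | h
    · omega
    · omega
    · omega
  rw [h6, h7]
  refine ⟨by ring, by omega, ?_⟩
  -- The gain of `p` comes from `g (c + 1) < b (c + 1)`, while `E` and `g` agree at `c + 1`.
  rw [← h8, h7]
  nlinarith

end Lattice

/-! ### Greedy filling of digits, and the submodular cost. -/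

section Fill

variable {f : ℕ} {p : ℤ} {y : ℕ → ℤ} {N : ℕ}

/-- `y` is a sequence of base `p` digits vanishing from `N` on. -/
structure IsDigits (p : ℤ) (N : ℕ) (y : ℕ → ℤ) : Prop where
  two_le : 2 ≤ p
  nonneg : ∀ k, 0 ≤ y k
  le : ∀ k, y k ≤ p - 1
  zero : ∀ k, N ≤ k → y k = 0

/-- The sum of the digits of index below `k` in the class of `k` modulo `f`. -/
def cumDigit (f : ℕ) (y : ℕ → ℤ) (k : ℕ) : ℤ :=
  ∑ j ∈ Finset.range k, if (j : ZMod f) = k then y j else 0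

/-- The sum of the digits of index below `N` in the class `l` modulo `f`. -/
def totalDigit (y : ℕ → ℤ) (N : ℕ) (l : ZMod f) : ℤ :=
  ∑ j ∈ Finset.range N, if (j : ZMod f) = l then y j else 0

/-- The `k`-th digit of the smallest number with digits bounded by `y` whose digits in the class
of `k` add up to `u`. -/
def fill (f : ℕ) (y : ℕ → ℤ) (k : ℕ) (u : ℤ) : ℤ := max 0 (min (y k) (u - cumDigit f y k))

theorem fill_nonneg (k : ℕ) (u : ℤ) : 0 ≤ fill f y k u := le_max_left _ _

theorem fill_le (hy : IsDigits p N y) (k : ℕ) (u : ℤ) : fill f y k u ≤ y k :=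
  max_le (hy.nonneg k) (min_le_left _ _)

theorem fill_mono (k : ℕ) {u v : ℤ} (h : u ≤ v) : fill f y k u ≤ fill f y k v := by
  unfold fill; omega

theorem cumDigit_add_le (hy : IsDigits p N y) {k m : ℕ} (h : k < m) (hc : (k : ZMod f) = m) :
    cumDigit f y k + y k ≤ cumDigit f y m := by
  unfold cumDigit
  have : Finset.range (k + 1) ⊆ Finset.range m := Finset.range_subset_range.2 h
  rw [← hc]
  calc _ = ∑ j ∈ Finset.range (k + 1), if (j : ZMod f) = k then y j else 0 := by
        rw [Finset.sum_range_succ, if_pos rfl]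
    _ ≤ _ := Finset.sum_le_sum_of_subset_of_nonneg this fun i _ _ => by
        split_ifs
        · exact hy.nonneg i
        · exact le_rfl

/-- Filling goes from the bottom, so a digit grows only once the lower digits of its class are full.
-/
theorem fill_eq_of_lt (hy : IsDigits p N y) {k m : ℕ} {u v : ℤ} (h : fill f y k u < fill f y k v)
    (hm : m < k) (hc : (m : ZMod f) = k) : fill f y m v = y m := by
  have h1 := cumDigit_add_le hy hm hc
  have h2 := hy.nonneg m
  unfold fill at *
  omega

theorem sum_fill_aux (hy : IsDigits p N y) (l : ZMod f) {u : ℤ} (hu : 0 ≤ u) (M : ℕ) :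
    (∑ k ∈ Finset.range M, if (k : ZMod f) = l then fill f y k u else 0) =
      min u (totalDigit y M l) := by
  induction M with
  | zero => simp [totalDigit, hu]
  | succ M ih =>
    rw [Finset.sum_range_succ, ih]
    unfold totalDigit
    rw [Finset.sum_range_succ]
    split_ifs with h
    · have h1 : cumDigit f y M = ∑ x ∈ Finset.range M, if (x : ZMod f) = l then y x else 0 := by
        rw [cumDigit, h]
      have h2 := hy.nonneg M
      unfold fill
      rw [h1]
      omega
    · simp

theorem sum_fill (hy : IsDigits p N y) (l : ZMod f) {u : ℤ} (hu : 0 ≤ u)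
    (hu' : u ≤ totalDigit y N l) :
    (∑ k ∈ Finset.range N, if (k : ZMod f) = l then fill f y k u else 0) = u := by
  rw [sum_fill_aux hy l hu, min_eq_left hu']

/-- This `k` is the position of the `U`-th unit when the class is filled from below. -/
theorem exists_index (hy : IsDigits p N y) {c : ZMod f} {U : ℤ} (h1 : 1 ≤ U)
    (h2 : U ≤ totalDigit y N c) :
    ∃ k, k < N ∧ (k : ZMod f) = c ∧ cumDigit f y k < U ∧ U ≤ cumDigit f y k + y k := by
  have e1 := sum_fill hy c (by omega) h2
  have e2 := sum_fill hy c (u := U - 1) (by omega) (by omega)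
  have hlt : (∑ k ∈ Finset.range N, if (k : ZMod f) = c then fill f y k (U - 1) else 0) <
      ∑ k ∈ Finset.range N, if (k : ZMod f) = c then fill f y k U else 0 := by omega
  obtain ⟨k, hk, hlt⟩ := Finset.exists_lt_of_sum_lt hlt
  split_ifs at hlt with hc
  · refine ⟨k, Finset.mem_range.1 hk, hc, ?_⟩
    unfold fill at hlt
    omega
  · omega

theorem fill_pred (hy : IsDigits p N y) {k : ℕ} {U : ℤ} (h1 : cumDigit f y k < U)
    (h2 : U ≤ cumDigit f y k + y k) (m : ℕ) (hm : (m : ZMod f) = k) :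
    fill f y m (U - 1) = fill f y m U - if m = k then 1 else 0 := by
  have := hy.nonneg m
  rcases lt_trichotomy m k with h | h | h
  · have := cumDigit_add_le hy h hm
    rw [if_neg h.ne]
    unfold fill
    omega
  · subst h
    rw [if_pos rfl]
    unfold fill
    omega
  · have := cumDigit_add_le hy h hm.symm
    rw [if_neg h.ne']
    unfold fill
    omega

/-- The smallest value of the part in the class `l` of a number with digits bounded by `y` whose
digits in this class add up to `u`. -/
def classCost (p : ℤ) (y : ℕ → ℤ) (N : ℕ) (l : ZMod f) (u : ℤ) : ℤ :=
  ∑ k ∈ Finset.range N, if (k : ZMod f) = l then p ^ k * fill f y k u else 0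

theorem classCost_pred (hy : IsDigits p N y) {k : ℕ} {U : ℤ} (hk : k < N)
    (h1 : cumDigit f y k < U) (h2 : U ≤ cumDigit f y k + y k) :
    classCost p y N (k : ZMod f) (U - 1) = classCost p y N (k : ZMod f) U - p ^ k := by
  unfold classCost
  have : p ^ k = ∑ m ∈ Finset.range N, if m = k then p ^ m else 0 := by
    rw [Finset.sum_ite_eq' (Finset.range N) k, if_pos (Finset.mem_range.2 hk)]
  rw [this, ← Finset.sum_sub_distrib]
  refine Finset.sum_congr rfl fun m _ => ?_
  by_cases hm : (m : ZMod f) = k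
  · rw [if_pos hm, if_pos hm, fill_pred hy h1 h2 m hm]
    split_ifs <;> ring
  · rw [if_neg hm, if_neg hm, if_neg (by rintro rfl; exact hm rfl), sub_zero]

/-- The `U`-th unit costs `p ^ k` with `k` its position, and positions increase with `U`. This is
convexity within one class. -/
theorem classCost_slope (hy : IsDigits p N y) (l : ZMod f) {U V : ℤ} (h1 : 1 ≤ U) (hUV : U ≤ V)
    (hV : V ≤ totalDigit y N l) :
    classCost p y N l U - classCost p y N l (U - 1) ≤
      classCost p y N l V - classCost p y N l (V - 1) := by
  obtain ⟨k, hk, rfl, hk1, hk2⟩ := exists_index hy h1 (hUV.trans hV)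
  obtain ⟨m, hm, hkm, hm1, hm2⟩ := exists_index hy (h1.trans hUV) hV
  have e1 := classCost_pred hy hk hk1 hk2
  have e2 := classCost_pred hy hm hm1 hm2
  rw [hkm] at e2
  rw [e1, e2]
  have : k ≤ m := by
    by_contra hcon
    have := cumDigit_add_le hy (not_le.1 hcon) hkm
    omega
  have := pow_le_pow_right₀ (by have := hy.two_le; omega : 1 ≤ p) this
  linarith

theorem classCost_convex_aux (hy : IsDigits p N y) (l : ZMod f) {w z : ℤ} (hw : 0 ≤ w)
    (hz : z ≤ totalDigit y N l) (t : ℕ) (ht : w + t ≤ z - t) :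
    classCost p y N l (w + t) + classCost p y N l (z - t) ≤
      classCost p y N l w + classCost p y N l z := by
  induction t with
  | zero => simp
  | succ t ih =>
    push_cast at ht ⊢
    have h1 := ih (by omega)
    have h2 := classCost_slope hy l (U := w + t + 1) (V := z - t) (by omega) (by omega) (by omega)
    rw [add_sub_cancel_right] at h2
    rw [show z - ((t : ℤ) + 1) = z - t - 1 by ring, ← add_assoc]
    linarith

theorem classCost_convex (hy : IsDigits p N y) (l : ZMod f) {u v x x' : ℤ} (hu : 0 ≤ u)
    (hv : 0 ≤ v) (hu' : u ≤ totalDigit y N l) (hv' : v ≤ totalDigit y N l)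
    (hx1 : min u v ≤ x) (hx2 : x ≤ max u v) (hx : x + x' = u + v) :
    classCost p y N l x + classCost p y N l x' ≤ classCost p y N l u + classCost p y N l v := by
  wlog huv : u ≤ v generalizing u v
  · have := this hv hu hv' hu' (by rwa [min_comm]) (by rwa [max_comm]) (by rw [hx, add_comm])
      (by omega)
    linarith
  wlog hxx : x ≤ x' generalizing x x'
  · have := this (x := x') (x' := x) (by omega) (by omega) (by omega) (by omega)
    linarith
  have := classCost_convex_aux hy l hu hv' (x - u).toNat (by omega)
  rwa [show u + ((x - u).toNat : ℤ) = x by omega, show v - ((x - u).toNat : ℤ) = x' by omega]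
    at this

/-- `E` comes from a number with digits bounded by `y`. -/
def Feasible (p : ℤ) (y : ℕ → ℤ) (N : ℕ) (E : ZMod f → ℤ) : Prop :=
  ∀ l, 0 ≤ digitSum p E l ∧ digitSum p E l ≤ totalDigit y N l

/-- The `k`-th digit of the smallest number with digits bounded by `y` that belongs to `E`. -/
def digitOf (p : ℤ) (y : ℕ → ℤ) (E : ZMod f → ℤ) (k : ℕ) : ℤ := fill f y k (digitSum p E k)

/-- The smallest number with digits bounded by `y` that belongs to `E`. -/
def cost (p : ℤ) (y : ℕ → ℤ) (N : ℕ) (E : ZMod f → ℤ) : ℤ :=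
  ∑ k ∈ Finset.range N, p ^ k * digitOf p y E k

theorem cost_eq_sum_classCost [NeZero f] (E : ZMod f → ℤ) :
    cost p y N E = ∑ l, classCost p y N l (digitSum p E l) := by
  unfold cost classCost digitOf
  rw [Finset.sum_comm]
  refine Finset.sum_congr rfl fun k _ => ?_
  rw [Finset.sum_ite_eq Finset.univ (k : ZMod f) fun l => p ^ k * fill f y k (digitSum p E l),
    if_pos (Finset.mem_univ _)]

/-- If `a` and `b` are ordered the same way at `l` and `l + 1`, the two digit sums are just
permuted; otherwise smaller and larger terms are recombined, which gives intermediate values. -/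
theorem digitSum_inf_sup (hp : 2 ≤ p) (a b : ZMod f → ℤ) (l : ZMod f) :
    digitSum p (a ⊓ b) l + digitSum p (a ⊔ b) l = digitSum p a l + digitSum p b l ∧
      min (digitSum p a l) (digitSum p b l) ≤ digitSum p (a ⊓ b) l ∧
      digitSum p (a ⊓ b) l ≤ max (digitSum p a l) (digitSum p b l) := by
  unfold digitSum
  simp only [Pi.inf_apply, Pi.sup_apply]
  rcases le_total (a l) (b l) with h | h <;> rcases le_total (a (l + 1)) (b (l + 1)) with h' | h' <;>
    have := mul_le_mul_of_nonneg_left h' (by omega : 0 ≤ p) <;>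
    first
    | rw [inf_of_le_left h, sup_of_le_right h]
    | rw [inf_of_le_right h, sup_of_le_left h]
  all_goals
    first
    | rw [inf_of_le_left h', sup_of_le_right h']
    | rw [inf_of_le_right h', sup_of_le_left h']
    omega

theorem Feasible.inf (hp : 2 ≤ p) {a b : ZMod f → ℤ} (ha : Feasible p y N a)
    (hb : Feasible p y N b) : Feasible p y N (a ⊓ b) := fun l => by
  have := digitSum_inf_sup hp a b l
  have := ha l
  have := hb l
  omega

theorem Feasible.sup (hp : 2 ≤ p) {a b : ZMod f → ℤ} (ha : Feasible p y N a)
    (hb : Feasible p y N b) : Feasible p y N (a ⊔ b) := fun l => by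
  have := digitSum_inf_sup hp a b l
  have := ha l
  have := hb l
  omega

theorem cost_add_le_of_between [NeZero f] (hy : IsDigits p N y) {a b e e' : ZMod f → ℤ}
    (ha : Feasible p y N a) (hb : Feasible p y N b)
    (he : ∀ l, digitSum p e l + digitSum p e' l = digitSum p a l + digitSum p b l ∧
      min (digitSum p a l) (digitSum p b l) ≤ digitSum p e l ∧
      digitSum p e l ≤ max (digitSum p a l) (digitSum p b l)) :
    cost p y N e + cost p y N e' ≤ cost p y N a + cost p y N b := by
  simp only [cost_eq_sum_classCost, ← Finset.sum_add_distrib]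
  refine Finset.sum_le_sum fun l _ => ?_
  obtain ⟨h1, h2, h3⟩ := he l
  exact classCost_convex hy l (ha l).1 (hb l).1 (ha l).2 (hb l).2 h2 h3 h1

/-- Submodularity: in each class the digit sums move closer together with the same total, and
`classCost` is convex. -/
theorem cost_inf_add_cost_sup_le [NeZero f] (hy : IsDigits p N y) {a b : ZMod f → ℤ}
    (ha : Feasible p y N a) (hb : Feasible p y N b) :
    cost p y N (a ⊓ b) + cost p y N (a ⊔ b) ≤ cost p y N a + cost p y N b :=
  cost_add_le_of_between hy ha hb fun l => digitSum_inf_sup hy.two_le a b l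

theorem eq_of_digitOf_eq [NeZero f] (hy : IsDigits p N y) {a b : ZMod f → ℤ}
    (ha : Feasible p y N a) (hb : Feasible p y N b)
    (h : ∀ k, k < N → digitOf p y a k = digitOf p y b k) : a = b := by
  refine digitSum_injective hy.two_le fun l => ?_
  rw [← sum_fill hy l (ha l).1 (ha l).2, ← sum_fill hy l (hb l).1 (hb l).2]
  refine Finset.sum_congr rfl fun k hk => ?_
  split_ifs with hl
  · subst hl; exact h k (Finset.mem_range.1 hk)
  · rfl

theorem digitOf_nonneg (E : ZMod f → ℤ) (k : ℕ) : 0 ≤ digitOf p y E k := fill_nonneg _ _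

theorem digitOf_le (hy : IsDigits p N y) (E : ZMod f → ℤ) (k : ℕ) : digitOf p y E k ≤ y k :=
  fill_le hy _ _

end Fill

/-! ### Comparing expansions by their highest difference. -/

section Lex

variable {f : ℕ} {p : ℤ} {N : ℕ}

theorem exists_top {x : ℕ → ℤ} (h : ∃ k < N, x k ≠ 0) :
    ∃ K < N, x K ≠ 0 ∧ ∀ k, K < k → k < N → x k = 0 := by
  classical
  obtain ⟨k, hk, hx⟩ := h
  obtain ⟨K, hK, hmax⟩ := Finset.exists_max_image ((Finset.range N).filter fun k => x k ≠ 0) id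
    ⟨k, by simp [hk, hx]⟩
  simp only [Finset.mem_filter, Finset.mem_range, id] at hK hmax
  refine ⟨K, hK.1, hK.2, fun m hm hmN => ?_⟩
  by_contra hne
  have := hmax m ⟨hmN, hne⟩
  omega

theorem geom_sum_int (p : ℤ) (K : ℕ) : ∑ k ∈ Finset.range K, p ^ k * (p - 1) = p ^ K - 1 := by
  rw [← Finset.sum_mul, geom_sum_mul]

theorem sum_range_top {x : ℕ → ℤ} {K : ℕ} (hK : K < N) (h0 : ∀ k, K < k → k < N → x k = 0) :
    ∑ k ∈ Finset.range N, p ^ k * x k = (∑ k ∈ Finset.range K, p ^ k * x k) + p ^ K * x K := by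
  rw [← Finset.sum_range_succ]
  symm
  refine Finset.sum_subset (Finset.range_subset_range.2 hK) fun k hk hk' => ?_
  rw [Finset.mem_range] at hk hk'
  rw [h0 k (by omega) hk, mul_zero]

/-- `∑ p ^ k` over the `k < K` congruent to `K` modulo `f`. -/
def classGeom (f : ℕ) (p : ℤ) (K : ℕ) : ℤ :=
  ∑ k ∈ Finset.range K, if (k : ZMod f) = K then p ^ k else 0

theorem classGeom_nonneg (hp : 2 ≤ p) (K : ℕ) : 0 ≤ classGeom f p K :=
  Finset.sum_nonneg fun k _ => by split_ifs <;> positivity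

theorem classGeom_mono (hp : 2 ≤ p) {K M : ℕ} (h : K ≤ M) :
    classGeom f p K ≤ classGeom f p M := by
  refine monotone_nat_of_le_succ (f := classGeom f p) (fun K => ?_) h
  unfold classGeom
  rw [Finset.sum_range_succ' _ K]
  have : (0 : ℤ) ≤ if ((0 : ℕ) : ZMod f) = ((K + 1 : ℕ) : ZMod f) then p ^ 0 else 0 := by
    split_ifs <;> positivity
  refine le_add_of_le_of_nonneg (Finset.sum_le_sum fun k _ => ?_) this
  have h1 : ((k + 1 : ℕ) : ZMod f) = ((K + 1 : ℕ) : ZMod f) ↔ (k : ZMod f) = K := by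
    push_cast; exact add_left_inj 1
  by_cases h : (k : ZMod f) = K
  · rw [if_pos h, if_pos (h1.2 h)]
    exact pow_le_pow_right₀ (by omega) (by omega)
  · rw [if_neg h, if_neg (fun hh => h (h1.1 hh))]

theorem classGeom_add_pow_le [NeZero f] (hp : 2 ≤ p) (K : ℕ) :
    classGeom f p K + p ^ K ≤ classGeom f p (K + f) := by
  unfold classGeom
  have hc : ((K + f : ℕ) : ZMod f) = K := by push_cast; simp
  rw [hc]
  calc _ = ∑ k ∈ Finset.range (K + 1), if (k : ZMod f) = K then p ^ k else 0 := by
        rw [Finset.sum_range_succ, if_pos rfl]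
    _ ≤ _ := by
        have := NeZero.pos f
        refine Finset.sum_le_sum_of_subset_of_nonneg (Finset.range_subset_range.2 (by omega))
          fun i _ _ => ?_
        split_ifs <;> positivity

/-- The leading `p ^ K` exceeds by `1` the worst loss, `p - 1` in every lower place. Each lower
place in the class of `K` cannot lose, which saves at least another `p ^ k`. -/
theorem one_add_classGeom_le (hp : 2 ≤ p) {x : ℕ → ℤ} {K : ℕ} (hK : K < N)
    (h0 : ∀ k, K < k → k < N → x k = 0) (h1 : 1 ≤ x K) (h2 : ∀ k, -(p - 1) ≤ x k)
    (h3 : ∀ k, k < K → (k : ZMod f) = K → 0 ≤ x k) :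
    1 + classGeom f p K ≤ ∑ k ∈ Finset.range N, p ^ k * x k := by
  rw [sum_range_top hK h0]
  have e : classGeom f p K ≤ (∑ k ∈ Finset.range K, p ^ k * x k) + (p ^ K - 1) := by
    rw [← geom_sum_int, ← Finset.sum_add_distrib]
    refine Finset.sum_le_sum fun k hk => ?_
    have hpk : 0 < p ^ k := by positivity
    split_ifs with h
    · have := h3 k (Finset.mem_range.1 hk) h
      nlinarith
    · have := h2 k
      nlinarith
  have : p ^ K ≤ p ^ K * x K := le_mul_of_one_le_right (by positivity) h1
  linarith

theorem sum_lt_pow (hp : 2 ≤ p) {x : ℕ → ℤ} {K : ℕ} (hK : K < N)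
    (h0 : ∀ k, K < k → k < N → x k = 0) (h2 : ∀ k, x k ≤ p - 1) :
    ∑ k ∈ Finset.range N, p ^ k * x k < p ^ (K + 1) := by
  rw [sum_range_top hK h0, ← Finset.sum_range_succ (fun k => p ^ k * x k)]
  have : ∑ k ∈ Finset.range (K + 1), p ^ k * x k ≤ ∑ k ∈ Finset.range (K + 1), p ^ k * (p - 1) :=
    Finset.sum_le_sum fun k _ => mul_le_mul_of_nonneg_left (h2 k) (by positivity)
  rw [geom_sum_int] at this
  linarith

theorem sum_pos_of_top (hp : 2 ≤ p) {x : ℕ → ℤ} {K : ℕ} (hK : K < N)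
    (h0 : ∀ k, K < k → k < N → x k = 0) (h1 : 1 ≤ x K) (h2 : ∀ k, -(p - 1) ≤ x k) :
    0 < ∑ k ∈ Finset.range N, p ^ k * x k := by
  -- Modulo `0` the class of `K` contains no smaller index, so the sign condition is vacuous.
  have h := one_add_classGeom_le (f := 0) hp hK h0 h1 h2 (fun k hk hkK => by
    have : k = K := by exact_mod_cast hkK
    omega)
  have := classGeom_nonneg (f := 0) hp K
  linarith

end Lex

/-! ### Increasing families and the interlacing inequality. -/

section Family

variable {f : ℕ} {p : ℤ} {y : ℕ → ℤ} {N : ℕ}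

/-- The `K`-th digit is the highest one in which `a` and `b` differ, and `b` has the larger one. -/
structure TopLt (p : ℤ) (y : ℕ → ℤ) (N : ℕ) (K : ℕ) (a b : ZMod f → ℤ) : Prop where
  lt_N : K < N
  lt : digitOf p y a K < digitOf p y b K
  eq : ∀ k, K < k → k < N → digitOf p y a k = digitOf p y b k

theorem cost_sub (a b : ZMod f → ℤ) :
    cost p y N b - cost p y N a =
      ∑ k ∈ Finset.range N, p ^ k * (digitOf p y b k - digitOf p y a k) := by
  simp only [cost, mul_sub, Finset.sum_sub_distrib]

/-- Below `K`, in the class of `K`, the digits of `b` are full, so only the other classes can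
contribute negatively. -/
theorem TopLt.classGeom_lt (hy : IsDigits p N y) {K : ℕ} {a b : ZMod f → ℤ}
    (h : TopLt p y N K a b) : 1 + classGeom f p K ≤ cost p y N b - cost p y N a := by
  rw [cost_sub]
  refine one_add_classGeom_le hy.two_le h.lt_N (fun k h1 h2 => ?_) ?_ (fun k => ?_)
    (fun k hk hc => ?_)
  · rw [h.eq k h1 h2, sub_self]
  · have := h.lt; omega
  · have := digitOf_nonneg (p := p) (y := y) b k
    have := digitOf_le hy a k
    have := hy.le k
    omega
  · have h1 := h.lt
    unfold digitOf at h1 ⊢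
    have h2 := fill_eq_of_lt hy h1 hk hc
    rw [hc, h2]
    exact sub_nonneg.2 (fill_le hy _ _)

theorem TopLt.lt_pow (hy : IsDigits p N y) {K : ℕ} {a b : ZMod f → ℤ}
    (h : TopLt p y N K a b) : cost p y N b - cost p y N a < p ^ (K + 1) := by
  rw [cost_sub]
  refine sum_lt_pow hy.two_le h.lt_N (fun k h1 h2 => ?_) (fun k => ?_)
  · rw [h.eq k h1 h2, sub_self]
  · have := digitOf_nonneg (p := p) (y := y) a k
    have := digitOf_le hy b k
    have := hy.le k
    omega

theorem TopLt.cost_lt (hy : IsDigits p N y) {K : ℕ} {a b : ZMod f → ℤ}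
    (h : TopLt p y N K a b) : cost p y N a < cost p y N b := by
  have := h.classGeom_lt hy
  have := classGeom_nonneg (f := f) hy.two_le K
  linarith

theorem exists_topLt [NeZero f] (hy : IsDigits p N y) {a b : ZMod f → ℤ}
    (ha : Feasible p y N a) (hb : Feasible p y N b) (h : a ≠ b) :
    ∃ K, TopLt p y N K a b ∨ TopLt p y N K b a := by
  have : ∃ k < N, digitOf p y b k - digitOf p y a k ≠ 0 := by
    by_contra! hcon
    exact h (eq_of_digitOf_eq hy ha hb fun k hk => (sub_eq_zero.1 (hcon k hk)).symm)
  obtain ⟨K, hK, h1, h2⟩ := exists_top this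
  refine ⟨K, ?_⟩
  rcases lt_or_gt_of_ne (sub_ne_zero.1 h1) with h3 | h3
  · exact Or.inr ⟨hK, h3, fun k hk hkN => sub_eq_zero.1 (h2 k hk hkN)⟩
  · exact Or.inl ⟨hK, h3, fun k hk hkN => (sub_eq_zero.1 (h2 k hk hkN)).symm⟩

theorem exists_topLt_of_cost_lt [NeZero f] (hy : IsDigits p N y) {a b : ZMod f → ℤ}
    (ha : Feasible p y N a) (hb : Feasible p y N b) (h : cost p y N a < cost p y N b) :
    ∃ K, TopLt p y N K a b := by
  obtain ⟨K, hK | hK⟩ := exists_topLt hy ha hb (by rintro rfl; exact h.false)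
  · exact ⟨K, hK⟩
  · exact absurd (hK.cost_lt hy) h.not_gt

theorem eq_of_cost_eq [NeZero f] (hy : IsDigits p N y) {a b : ZMod f → ℤ}
    (ha : Feasible p y N a) (hb : Feasible p y N b) (h : cost p y N a = cost p y N b) : a = b := by
  by_contra hne
  obtain ⟨K, hK | hK⟩ := exists_topLt hy ha hb hne
  · exact (hK.cost_lt hy).ne h
  · exact (hK.cost_lt hy).ne h.symm

/-- Otherwise `g` would agree with `E` from `K` on, and so be cheaper than `a`. -/
theorem TopLt.exists_ge [NeZero f] (hy : IsDigits p N y) {a E g : ZMod f → ℤ}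
    (hE : Feasible p y N E) (hg : Feasible p y N g) {K : ℕ} (h : TopLt p y N K E a)
    (hag : cost p y N a ≤ cost p y N g) : ∃ M, K ≤ M ∧ TopLt p y N M E g := by
  obtain ⟨M, hM⟩ := exists_topLt_of_cost_lt hy hE hg ((h.cost_lt hy).trans_le hag)
  refine ⟨M, ?_, hM⟩
  by_contra hlt
  rw [not_le] at hlt
  have : TopLt p y N K g a := ⟨h.lt_N, by rw [← hM.eq K hlt h.lt_N]; exact h.lt,
    fun k hk hkN => by rw [← hM.eq k (hlt.trans hk) hkN]; exact h.eq k hk hkN⟩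
  exact (this.cost_lt hy).not_ge hag

/-- A strictly increasing family of `n` positive feasible vectors. -/
structure IsFamily (p : ℤ) (y : ℕ → ℤ) (N : ℕ) (n : ℕ) (a : ℕ → ZMod f → ℤ) : Prop where
  feas : ∀ i < n, Feasible p y N (a i)
  pos : ∀ i < n, ∀ l, 0 < a i l
  lt : ∀ i, i + 1 < n → ∀ l, a i l < a (i + 1) l

/-- The total cost of a family. -/
def familyCost (p : ℤ) (y : ℕ → ℤ) (N : ℕ) (n : ℕ) (a : ℕ → ZMod f → ℤ) : ℤ :=
  ∑ i ∈ Finset.range n, cost p y N (a i)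

/-- A family of minimal cost among those of the same size. -/
def IsOptimal (p : ℤ) (y : ℕ → ℤ) (N : ℕ) (n : ℕ) (a : ℕ → ZMod f → ℤ) : Prop :=
  IsFamily p y N n a ∧ ∀ b : ℕ → ZMod f → ℤ, IsFamily p y N n b →
    familyCost p y N n a ≤ familyCost p y N n b

theorem IsOptimal.cost_le {n : ℕ} {a : ℕ → ZMod f → ℤ} (ha : IsOptimal p y N n a) {r : ℕ}
    (hr : r < n) {g : ZMod f → ℤ} (hg : Feasible p y N g) (hpos : ∀ l, 0 < g l)
    (hlow : ∀ s, s + 1 = r → ∀ l, a s l < g l) (hup : r + 1 < n → ∀ l, g l < a (r + 1) l) :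
    cost p y N (a r) ≤ cost p y N g := by
  classical
  have hu : ∀ i, Function.update a r g i = if i = r then g else a i := fun i => by
    simp [Function.update_apply]
  have hfam : IsFamily p y N n (Function.update a r g) := by
    refine ⟨fun i hi => ?_, fun i hi => ?_, fun i hi => ?_⟩
    · rw [hu]; split_ifs
      · exact hg
      · exact ha.1.feas i hi
    · rw [hu]; split_ifs
      · exact hpos
      · exact ha.1.pos i hi
    · rw [hu, hu]
      by_cases h1 : i = r
      · subst h1
        rw [if_pos rfl, if_neg (by omega)]
        exact hup hi
      · rw [if_neg h1]
        split_ifs with h2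
        · exact hlow i h2
        · exact ha.1.lt i hi
  have h := ha.2 _ hfam
  unfold familyCost at h
  rw [← Finset.add_sum_erase _ _ (Finset.mem_range.2 hr),
    ← Finset.add_sum_erase (Finset.range n) (fun i => cost p y N (Function.update a r g i))
      (Finset.mem_range.2 hr)] at h
  have h2 : ∑ i ∈ (Finset.range n).erase r, cost p y N (Function.update a r g i) =
      ∑ i ∈ (Finset.range n).erase r, cost p y N (a i) := by
    refine Finset.sum_congr rfl fun i hi => ?_
    rw [hu, if_neg (Finset.ne_of_mem_erase hi)]
  rw [h2, hu, if_pos rfl] at h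
  linarith

/-- A cheaper replacement `E` of a member of an optimal family is blocked by the next member, and
this one has a unit of a digit much higher than the ones changed by the replacement. -/
theorem IsOptimal.blocked [NeZero f] (hy : IsDigits p N y) {n : ℕ} {a : ℕ → ZMod f → ℤ}
    (ha : IsOptimal p y N n a) {r : ℕ} (hr : r < n) {E : ZMod f → ℤ} (hE : Feasible p y N E)
    (haE : a r ≤ E) (hEa : r + 1 < n → E ≤ a (r + 1)) {K : ℕ} (hK : TopLt p y N K E (a r)) :
    r + 1 < n ∧ ∃ (c : ZMod f) (M : ℕ), K + f ≤ M ∧ M < N ∧ (M : ZMod f) = c ∧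
      E c = a (r + 1) c ∧ cumDigit f y M < digitSum p (a (r + 1)) c ∧
      digitSum p (a (r + 1)) c ≤ cumDigit f y M + y M := by
  have hp := hy.two_le
  have hlt := hK.cost_lt hy
  have hpos : ∀ g : ZMod f → ℤ, a r ≤ g → ∀ l, 0 < g l := fun g hg l =>
    (ha.1.pos r hr l).trans_le (hg l)
  have hlow : ∀ g : ZMod f → ℤ, a r ≤ g → ∀ s, s + 1 = r → ∀ l, a s l < g l := by
    rintro g hg s rfl l
    exact (ha.1.lt s hr l).trans_le (hg l)
  have hr1 : r + 1 < n := by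
    by_contra hcon
    exact hlt.not_ge (ha.cost_le hr hE (hpos E haE) (hlow E haE) (fun h => absurd h hcon))
  refine ⟨hr1, ?_⟩
  -- `E` may touch `a (r + 1)`; `g` is a maximal admissible replacement below it, and optimality
  -- forbids that it be cheaper than `a r`.
  obtain ⟨g, hag, hgE, hgb, hug, hg⟩ := exists_maximal_below hp haE (hEa hr1) (ha.1.lt r hr1)
    (fun l => (ha.1.feas r hr l).1) (fun l => (hE l).1)
  have hgf : Feasible p y N g := fun l => by
    refine ⟨hug l, ?_⟩
    by_cases h : digitSum p E l < digitSum p g l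
    · obtain ⟨h1, -, h2⟩ := hg l h
      have := (ha.1.feas (r + 1) hr1 l).2
      omega
    · have := (hE l).2
      omega
  have hle := ha.cost_le hr hgf (hpos g hag) (hlow g hag) fun _ => hgb
  obtain ⟨M, hKM, hM⟩ := hK.exists_ge hy hE hgf hle
  have hMlt := hM.lt
  unfold digitOf at hMlt
  have hul : digitSum p E M < digitSum p g M := by
    by_contra hcon
    exact absurd (fill_mono (f := f) (y := y) M (not_lt.1 hcon)) (not_le.2 hMlt)
  obtain ⟨h1, h2, h3⟩ := hg M hul
  obtain ⟨M', hM'N, hM'c, h4, h5⟩ := exists_index hy (c := (M : ZMod f))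
    (U := digitSum p (a (r + 1)) M) (by have := (hE M).1; omega) (ha.1.feas (r + 1) hr1 M).2
  refine ⟨M, M', ?_, hM'N, hM'c, h2, h4, h5⟩
  -- In this class `a (r + 1)` has at least `p` units more than `E`, which already reaches the digit
  -- `M`. That digit holds at most `p - 1`, so the last unit of `a (r + 1)` lies higher, hence at
  -- least `f` higher.
  have hlt' : M < M' := by
    by_contra hcon
    have h6 : cumDigit f y M' + y M' ≤ cumDigit f y M + y M := by
      rcases (not_lt.1 hcon).eq_or_lt with h | h
      · rw [h]
      · have := cumDigit_add_le hy h hM'c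
        have := hy.nonneg M
        omega
    have h7 := hy.le M
    unfold fill at hMlt
    omega
  have : f ≤ M' - M := by
    have hd : ((M' - M : ℕ) : ZMod f) = 0 := by
      rw [Nat.cast_sub hlt'.le, hM'c, sub_self]
    exact Nat.le_of_dvd (by omega) ((ZMod.natCast_eq_zero_iff _ _).1 hd)
  omega

/-- If no digit above `M` changes between `a` and `b`, and `a` has a unit of the digit `M` in a
class in which `a` increases, then there is a cheaper element between `a` and `b`. -/
theorem exists_cheaper [NeZero f] (hy : IsDigits p N y) {a b : ZMod f → ℤ}
    (ha : Feasible p y N a) (hb : Feasible p y N b) (hab : a ≤ b) {c : ZMod f} {M : ℕ}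
    (hM : M < N) (hMc : (M : ZMod f) = c) (h1 : cumDigit f y M < digitSum p a c)
    (h2 : digitSum p a c ≤ cumDigit f y M + y M) (hc : a c < b c)
    (hd : ∀ k, M < k → k < N → digitOf p y a k = digitOf p y b k) :
    ∃ E, a ≤ E ∧ E ≤ b ∧ Feasible p y N E ∧ TopLt p y N M E a := by
  have hp := hy.two_le
  have h0 : 0 ≤ cumDigit f y M := Finset.sum_nonneg fun i _ => by
    split_ifs
    · exact hy.nonneg i
    · exact le_rfl
  -- If `b` has more units than `a` in the class `c`, they still end at `M` or below, so there are
  -- at most `cumDigit f y M + p - 1` of them, while `a` has at least `cumDigit f y M + 1`.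
  have hcb : digitSum p b c ≤ digitSum p a c + p - 2 := by
    have hyM := hy.le M
    by_cases hle : digitSum p b c ≤ digitSum p a c
    · omega
    obtain ⟨k, hkN, hkc, h3, h4⟩ := exists_index hy (c := c) (U := digitSum p b c) (by omega)
      (hb c).2
    have hkM : k ≤ M := by
      by_contra hlt
      rw [not_le] at hlt
      have h5 := hd k hlt hkN
      have h6 := cumDigit_add_le hy hlt (hMc.trans hkc.symm)
      unfold digitOf fill at h5
      rw [hkc] at h5
      omega
    have : cumDigit f y k + y k ≤ cumDigit f y M + y M := by
      rcases hkM.eq_or_lt with h | h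
      · rw [h]
      · have := cumDigit_add_le hy h (hkc.trans hMc.symm)
        have := hy.nonneg M
        omega
    omega
  obtain ⟨e, hae, heb, hec, hel, -, -⟩ := exists_exchange hp hab hc hcb
  have hef : Feasible p y N e := fun l => by
    by_cases hl : l = c
    · subst hl
      have := (ha l).2
      omega
    · have := hel l hl
      have := ha l
      have := hb l
      omega
  refine ⟨e, hae, heb, hef, hM, ?_, fun k hk hkN => ?_⟩
  · unfold digitOf
    rw [hMc, hec, fill_pred hy h1 h2 M rfl, if_pos rfl]
    omega
  · unfold digitOf
    by_cases hkc : (k : ZMod f) = c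
    · rw [hkc, hec, fill_pred hy h1 h2 k
        (hkc.trans hMc.symm), if_neg hk.ne', sub_zero]
    · have h3 := hel k hkc
      have h4 := hd k hk hkN
      unfold digitOf at h4
      refine le_antisymm ?_ (fill_mono k h3.1)
      rcases le_max_iff.1 h3.2 with h5 | h5
      · exact fill_mono k h5
      · rw [h4]; exact fill_mono k h5

/-- An optimal family is strictly cheaper than a different one interlacing it from above. -/
theorem IsOptimal.lt_or_eq_of_interlaced [NeZero f] (hy : IsDigits p N y) {n : ℕ}
    {a b : ℕ → ZMod f → ℤ} (ha : IsOptimal p y N n a) (hb : IsFamily p y N n b)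
    (hab : ∀ i < n, a i ≤ b i) (hba : ∀ i, i + 1 < n → b i ≤ a (i + 1)) :
    familyCost p y N n a < familyCost p y N n b ∨ ∀ i < n, a i = b i := by
  have hp := hy.two_le
  set x : ℕ → ℤ := fun i => cost p y N (b i) - cost p y N (a i) with hx
  set S : ℕ → ℤ := fun r => ∑ i ∈ Finset.range r, x i with hS
  have hSs : ∀ r, S (r + 1) = S r + x r := fun r => Finset.sum_range_succ _ _
  -- Either the first `r` members are settled (a gain, or equality throughout), or the last of them
  -- has a cheaper replacement `E` with top difference `K`, and the debt `-S r` is bounded in terms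
  -- of `K`.
  have hmain : ∀ r, r ≤ n → (0 < S r ∨ (S r = 0 ∧ ∀ i < r, a i = b i)) ∨
      ∃ s E K, r = s + 1 ∧ a s ≤ E ∧ E ≤ b s ∧ Feasible p y N E ∧ TopLt p y N K E (a s) ∧
        -S r < classGeom f p (K + 1 + f) := by
    intro r
    induction r with
    | zero => exact fun _ => Or.inl (Or.inr ⟨by simp [hS], by simp⟩)
    | succ r ih =>
      intro hr
      have hr' : r < n := hr
      rcases ih hr'.le with hsafe | ⟨s, E, K, rfl, haE, hEb, hE, hK, hlt⟩
      · by_cases heq : a r = b r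
        · left
          have hx0 : x r = 0 := by simp [hx, heq]
          rw [hSs, hx0, add_zero]
          refine hsafe.imp id fun h => ⟨h.1, fun i hi => ?_⟩
          rcases Nat.lt_succ_iff_lt_or_eq.1 hi with h1 | rfl
          · exact h.2 i h1
          · exact heq
        have hS0 : 0 ≤ S r := hsafe.elim (fun h => h.le) fun h => h.1.ge
        obtain ⟨K, hK | hK⟩ := exists_topLt hy (ha.1.feas r hr') (hb.feas r hr') heq
        · left; left
          have := hK.cost_lt hy
          have : 0 < x r := sub_pos.2 this
          rw [hSs]; linarith
        · right
          refine ⟨r, b r, K, rfl, hab r hr', le_rfl, hb.feas r hr', hK, ?_⟩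
          have h1 := hK.lt_pow hy
          have h2 := classGeom_add_pow_le (f := f) hp (K + 1)
          have h3 := classGeom_nonneg (f := f) hp (K + 1)
          rw [hSs]
          simp only [hx]
          linarith
      · obtain ⟨-, c, M, hKM, hMN, hMc, hEc, hM1, hM2⟩ := ha.blocked hy (by omega : s < n) hE haE
          (fun h => hEb.trans (hba s h)) hK
        -- The blocking member touches `E` at `c`, whereas `b (s + 1)` is strictly above `b s ≥ E`.
        have hc : a (s + 1) c < b (s + 1) c := by
          rw [← hEc]; exact (hEb c).trans_lt (hb.lt s hr c)
        have hne : a (s + 1) ≠ b (s + 1) := fun h => by rw [h] at hc; exact hc.false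
        obtain ⟨L, hL⟩ := exists_topLt hy (ha.1.feas _ hr') (hb.feas _ hr') hne
        have hxlow : -x (s + 1) < p ^ (L + 1) := by
          rcases hL with hL | hL
          · have := hL.cost_lt hy
            have : 0 < p ^ (L + 1) := by positivity
            simp only [hx]; linarith
          · have := hL.lt_pow hy
            simp only [hx]; linarith
        -- If `L ≤ M`, an exchange at `M` gives the next cheaper replacement, and the new loss,
        -- below `p ^ (M + 1)`, fits in the bound because `M ≥ K + f`. If `L > M`, either `b (s +
        -- 1)` is dearer and repays the whole debt, or it is itself the next cheaper replacement.
        by_cases hLM : L ≤ M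
        · right
          obtain ⟨E', h1, h2, h3, h4⟩ := exists_cheaper hy (ha.1.feas _ hr') (hb.feas _ hr')
            (hab _ hr') hMN hMc hM1 hM2 hc (fun k hk hkN => by
              rcases hL with hL | hL
              · exact hL.eq k (by omega) hkN
              · exact (hL.eq k (by omega) hkN).symm)
          refine ⟨s + 1, E', M, rfl, h1, h2, h3, h4, ?_⟩
          have h5 := classGeom_add_pow_le (f := f) hp (M + 1)
          have h6 := classGeom_mono (f := f) hp (K := K + 1 + f) (M := M + 1) (by omega)
          have h7 : p ^ (L + 1) ≤ p ^ (M + 1) := pow_le_pow_right₀ (by omega) (by omega)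
          rw [hSs]
          linarith
        · rcases hL with hL | hL
          · left; left
            have h1 := hL.classGeom_lt hy
            have h2 := classGeom_mono (f := f) hp (K := K + 1 + f) (M := L) (by omega)
            rw [hSs]
            simp only [hx]
            linarith
          · right
            refine ⟨s + 1, b (s + 1), L, rfl, hab _ hr', le_rfl, hb.feas _ hr', hL, ?_⟩
            have h5 := classGeom_add_pow_le (f := f) hp (L + 1)
            have h6 := classGeom_mono (f := f) hp (K := K + 1 + f) (M := L + 1) (by omega)
            rw [hSs]
            linarith
  have hSn : S n = familyCost p y N n b - familyCost p y N n a := by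
    simp only [hS, hx, familyCost, Finset.sum_sub_distrib]
  rcases hmain n le_rfl with (h | h) | ⟨s, E, K, rfl, haE, hEb, hE, hK, -⟩
  · left; linarith
  · exact Or.inr h.2
  -- The last member has no successor to block its replacement.
  · have := (ha.blocked hy (by omega : s < s + 1) hE haE (fun h => hEb.trans (hba s h)) hK).1
    omega

end Family

/-! ### Uniqueness, monotonicity and convexity of optimal families. -/

section Optimal

variable {f : ℕ} {p : ℤ} {y : ℕ → ℤ} {N : ℕ}

/-- Trimming `b i` to `b i ⊓ a (i + 1)` costs nothing by submodularity, since the complementary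
family of suprema is no cheaper than `a`. The trimmed family interlaces `a`, so it equals `a`; as `a
i < a (i + 1)`, nothing was trimmed. -/
theorem IsOptimal.eq_of_le [NeZero f] (hy : IsDigits p N y) {n : ℕ}
    {a b : ℕ → ZMod f → ℤ} (ha : IsOptimal p y N n a) (hb : IsOptimal p y N n b)
    (hab : ∀ i < n, a i ≤ b i) : ∀ i < n, a i = b i := by
  have hp := hy.two_le
  obtain _ | m := n
  · simp
  set b' : ℕ → ZMod f → ℤ := fun i => if i < m then b i ⊓ a (i + 1) else b i with hb'
  set c : ℕ → ZMod f → ℤ := fun i => Nat.casesOn i (a 0) fun s => b s ⊔ a (s + 1) with hc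
  have hb'1 : ∀ i, i < m → b' i = b i ⊓ a (i + 1) := fun i hi => if_pos hi
  have hb'2 : b' m = b m := if_neg (lt_irrefl m)
  have hb'le : ∀ i, b' i ≤ b i := fun i => by
    rw [hb']; dsimp only; split_ifs
    · exact inf_le_left
    · exact le_rfl
  have hb'fam : IsFamily p y N (m + 1) b' := by
    refine ⟨fun i hi => ?_, fun i hi l => ?_, fun i hi l => ?_⟩
    · rcases Nat.lt_succ_iff_lt_or_eq.1 hi with h | rfl
      · rw [hb'1 i h]
        exact (hb.1.feas i hi).inf hp (ha.1.feas _ (by omega))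
      · rw [hb'2]; exact hb.1.feas i hi
    · rcases Nat.lt_succ_iff_lt_or_eq.1 hi with h | rfl
      · rw [hb'1 i h]
        exact lt_min (hb.1.pos i hi l) (ha.1.pos _ (by omega) l)
      · rw [hb'2]; exact hb.1.pos i hi l
    · have h1 := hb.1.lt i hi l
      rcases Nat.lt_succ_iff_lt_or_eq.1 hi with h | h
      · rw [hb'1 _ h, hb'1 i (by omega)]
        exact lt_min ((min_le_left _ _).trans_lt h1)
          ((min_le_right _ _).trans_lt (ha.1.lt (i + 1) (by omega) l))
      · have := hb'le i l
        rw [h, hb'2, ← h]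
        exact this.trans_lt h1
  have hcfam : IsFamily p y N (m + 1) c := by
    refine ⟨fun i hi => ?_, fun i hi l => ?_, fun i hi l => ?_⟩
    · obtain _ | i := i
      · exact ha.1.feas 0 hi
      · exact (hb.1.feas i (by omega)).sup hp (ha.1.feas _ hi)
    · obtain _ | i := i
      · exact ha.1.pos 0 hi l
      · exact (ha.1.pos _ hi l).trans_le (le_max_right _ _)
    · obtain _ | i := i
      · exact (ha.1.lt 0 hi l).trans_le (le_max_right _ _)
      · exact max_lt_max (hb.1.lt i (by omega) l) (ha.1.lt _ hi l)
  have hsum : familyCost p y N (m + 1) b' + familyCost p y N (m + 1) c ≤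
      familyCost p y N (m + 1) b + familyCost p y N (m + 1) a := by
    unfold familyCost
    rw [Finset.sum_range_succ, Finset.sum_range_succ' _ m, Finset.sum_range_succ _ m,
      Finset.sum_range_succ' _ m, hb'2]
    have : ∑ i ∈ Finset.range m, cost p y N (b' i) + ∑ i ∈ Finset.range m, cost p y N (c (i + 1)) ≤
        ∑ i ∈ Finset.range m, cost p y N (b i) +
          ∑ i ∈ Finset.range m, cost p y N (a (i + 1)) := by
      rw [← Finset.sum_add_distrib, ← Finset.sum_add_distrib]
      refine Finset.sum_le_sum fun i hi => ?_
      rw [Finset.mem_range] at hi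
      rw [hb'1 i hi]
      exact cost_inf_add_cost_sup_le hy (hb.1.feas i (by omega)) (ha.1.feas _ (by omega))
    have h0 : cost p y N (c 0) = cost p y N (a 0) := rfl
    linarith
  have h1 := ha.2 c hcfam
  have h2 := hb.2 a ha.1
  have h3 := ha.lt_or_eq_of_interlaced hy hb'fam (fun i hi => ?_) fun i hi => ?_
  · have h4 := h3.resolve_left (by linarith)
    intro i hi
    rcases Nat.lt_succ_iff_lt_or_eq.1 hi with h | rfl
    · have h5 := h4 i hi
      rw [hb'1 i h] at h5
      ext l
      have h6 := congrFun h5 l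
      have h7 := ha.1.lt i (by omega) l
      simp only [Pi.inf_apply] at h6
      omega
    · rw [h4 i hi, hb'2]
  · rcases Nat.lt_succ_iff_lt_or_eq.1 hi with h | rfl
    · rw [hb'1 i h]
      exact le_inf (hab i hi) fun l => (ha.1.lt i (by omega) l).le
    · rw [hb'2]; exact hab i hi
  · rw [hb'1 i (by omega)]
    exact inf_le_right

/-- There is at most one optimal family of each size. -/
theorem IsOptimal.unique [NeZero f] (hy : IsDigits p N y) {n : ℕ}
    {a b : ℕ → ZMod f → ℤ} (ha : IsOptimal p y N n a) (hb : IsOptimal p y N n b) :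
    ∀ i < n, a i = b i := by
  have hp := hy.two_le
  have hinf : IsFamily p y N n fun i => a i ⊓ b i :=
    ⟨fun i hi => (ha.1.feas i hi).inf hp (hb.1.feas i hi),
      fun i hi l => lt_min (ha.1.pos i hi l) (hb.1.pos i hi l),
      fun i hi l => min_lt_min (ha.1.lt i hi l) (hb.1.lt i hi l)⟩
  have hsup : IsFamily p y N n fun i => a i ⊔ b i :=
    ⟨fun i hi => (ha.1.feas i hi).sup hp (hb.1.feas i hi),
      fun i hi l => (ha.1.pos i hi l).trans_le (le_max_left _ _),
      fun i hi l => max_lt_max (ha.1.lt i hi l) (hb.1.lt i hi l)⟩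
  have hsum : familyCost p y N n (fun i => a i ⊓ b i) + familyCost p y N n (fun i => a i ⊔ b i) ≤
      familyCost p y N n a + familyCost p y N n b := by
    unfold familyCost
    rw [← Finset.sum_add_distrib, ← Finset.sum_add_distrib]
    refine Finset.sum_le_sum fun i hi => ?_
    rw [Finset.mem_range] at hi
    exact cost_inf_add_cost_sup_le hy (ha.1.feas i hi) (hb.1.feas i hi)
  have h1 := ha.2 _ hsup
  have h2 := hb.2 _ hsup
  have h3 := ha.2 b hb.1
  have h4 := hb.2 a ha.1
  -- By submodularity the infimum of two optimal families is optimal, which reduces to comparable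
  -- families.
  have hopt : IsOptimal p y N n fun i => a i ⊓ b i :=
    ⟨hinf, fun c hc => by have := ha.2 c hc; linarith⟩
  intro i hi
  exact (hopt.eq_of_le hy ha (fun i _ => inf_le_left) i hi).symm.trans
    (hopt.eq_of_le hy hb (fun i _ => inf_le_right) i hi)

/-- The digit sums of an optimal family increase. -/
theorem IsOptimal.digitSum_mono [NeZero f] (hy : IsDigits p N y) {n : ℕ}
    {a : ℕ → ZMod f → ℤ} (ha : IsOptimal p y N n a) {r : ℕ} (hr : r + 1 < n) (c : ZMod f) :
    digitSum p (a r) c ≤ digitSum p (a (r + 1)) c := by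
  have hp := hy.two_le
  by_contra! hlt
  have hr' : r < n := by omega
  have hfa := ha.1.feas r hr'
  have hfb := ha.1.feas (r + 1) hr
  have hab := ha.1.lt r hr
  -- A drop in the class `c` makes the gap at `c` exceed `p` times the gap at `c + 1`, which is at
  -- least `1`.
  have hc : a r c + 1 < a (r + 1) c := by
    have := hab (c + 1)
    unfold digitSum at hlt
    nlinarith
  obtain ⟨e, hae, heb, hec, hel, -, hlt'⟩ := exists_exchange hp (fun l => (hab l).le)
    (hab c) (by omega)
  have heb' := hlt' hab hc
  -- What `a r` gains is taken from `a (r + 1)`. Both replacements are admissible, so neither is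
  -- cheaper; submodularity then forces equal costs, hence `a r = e`, against the unit lost at `c`.
  set e' : ZMod f → ℤ := fun l => a r l + a (r + 1) l - e l with he'
  have hbetween : ∀ l, digitSum p e l + digitSum p e' l =
      digitSum p (a r) l + digitSum p (a (r + 1)) l ∧
      min (digitSum p (a r) l) (digitSum p (a (r + 1)) l) ≤ digitSum p e l ∧
      digitSum p e l ≤ max (digitSum p (a r) l) (digitSum p (a (r + 1)) l) := by
    intro l
    refine ⟨by simp only [digitSum, he']; ring, ?_⟩
    by_cases hl : l = c
    · subst hl; omega
    · have := hel l hl; omega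
  have hcost := cost_add_le_of_between hy hfa hfb hbetween
  have hfe : Feasible p y N e := fun l => by
    have := hbetween l; have := hfa l; have := hfb l; omega
  have hfe' : Feasible p y N e' := fun l => by
    have := hbetween l; have := hfa l; have := hfb l; omega
  have h1 := ha.cost_le hr' hfe (fun l => (ha.1.pos r hr' l).trans_le (hae l))
    (by rintro s rfl l; exact (ha.1.lt s hr' l).trans_le (hae l)) fun _ => heb'
  have h2 := ha.cost_le hr hfe'
    (fun l => by have := ha.1.pos r hr' l; have := heb' l; simp only [he']; omega)
    (fun s hs l => by
      obtain rfl : s = r := by omega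
      have := heb' l
      simp only [he']; omega)
    (fun h l => by
      have := ha.1.lt (r + 1) h l
      have : a r l ≤ e l := hae l
      simp only [he']; omega)
  have h3 : cost p y N (a r) = cost p y N e := by linarith
  have h4 := eq_of_cost_eq hy hfa hfe h3
  rw [← h4] at hec
  omega

/-- The costs of the optimal families are strictly convex in the size. -/
theorem IsOptimal.two_mul_lt [NeZero f] (hy : IsDigits p N y) {n : ℕ}
    {a b c : ℕ → ZMod f → ℤ} (ha : IsOptimal p y N n a) (hb : IsOptimal p y N (n + 1) b)
    (hc : IsOptimal p y N (n + 2) c) :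
    2 * familyCost p y N (n + 1) b < familyCost p y N n a + familyCost p y N (n + 2) c := by
  have hp := hy.two_le
  set u : ℕ → ZMod f → ℤ := fun i => if i < n then a i ⊓ c (i + 1) else c (i + 1) with hu
  set v : ℕ → ZMod f → ℤ := fun i => Nat.casesOn i (c 0) fun s => a s ⊔ c (s + 1) with hv
  have hu1 : ∀ i, i < n → u i = a i ⊓ c (i + 1) := fun i hi => if_pos hi
  have hu2 : u n = c (n + 1) := if_neg (lt_irrefl n)
  have hule : ∀ i, u i ≤ c (i + 1) := fun i => by
    rw [hu]; dsimp only; split_ifs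
    · exact inf_le_right
    · exact le_rfl
  have hufam : IsFamily p y N (n + 1) u := by
    refine ⟨fun i hi => ?_, fun i hi l => ?_, fun i hi l => ?_⟩
    · rcases Nat.lt_succ_iff_lt_or_eq.1 hi with h | rfl
      · rw [hu1 i h]
        exact (ha.1.feas i h).inf hp (hc.1.feas _ (by omega))
      · rw [hu2]; exact hc.1.feas _ (by omega)
    · rcases Nat.lt_succ_iff_lt_or_eq.1 hi with h | rfl
      · rw [hu1 i h]
        exact lt_min (ha.1.pos i h l) (hc.1.pos _ (by omega) l)
      · rw [hu2]; exact hc.1.pos _ (by omega) l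
    · have h1 := hc.1.lt (i + 1) (by omega) l
      rcases Nat.lt_succ_iff_lt_or_eq.1 hi with h | h
      · rw [hu1 _ h, hu1 i (by omega)]
        exact lt_min ((min_le_left _ _).trans_lt (ha.1.lt i (by omega) l))
          ((min_le_right _ _).trans_lt h1)
      · have := hule i l
        rw [h, hu2, ← h]
        exact this.trans_lt h1
  have hvfam : IsFamily p y N (n + 1) v := by
    refine ⟨fun i hi => ?_, fun i hi l => ?_, fun i hi l => ?_⟩
    · obtain _ | i := i
      · exact hc.1.feas 0 (by omega)
      · exact (ha.1.feas i (by omega)).sup hp (hc.1.feas _ (by omega))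
    · obtain _ | i := i
      · exact hc.1.pos 0 (by omega) l
      · exact (hc.1.pos _ (by omega) l).trans_le (le_max_right _ _)
    · obtain _ | i := i
      · exact (hc.1.lt 0 (by omega) l).trans_le (le_max_right _ _)
      · exact max_lt_max (ha.1.lt i (by omega) l) (hc.1.lt _ (by omega) l)
  have hsum : familyCost p y N (n + 1) u + familyCost p y N (n + 1) v ≤
      familyCost p y N n a + familyCost p y N (n + 2) c := by
    unfold familyCost
    rw [Finset.sum_range_succ, Finset.sum_range_succ' _ n, Finset.sum_range_succ' _ (n + 1),
      Finset.sum_range_succ _ n, hu2]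
    have : ∑ i ∈ Finset.range n, cost p y N (u i) + ∑ i ∈ Finset.range n, cost p y N (v (i + 1)) ≤
        ∑ i ∈ Finset.range n, cost p y N (a i) +
          ∑ i ∈ Finset.range n, cost p y N (c (i + 1)) := by
      rw [← Finset.sum_add_distrib, ← Finset.sum_add_distrib]
      refine Finset.sum_le_sum fun i hi => ?_
      rw [Finset.mem_range] at hi
      rw [hu1 i hi]
      exact cost_inf_add_cost_sup_le hy (ha.1.feas i hi) (hc.1.feas _ (by omega))
    have h0 : cost p y N (v 0) = cost p y N (c 0) := rfl
    linarith
  have h1 := hb.2 u hufam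
  have h2 := hb.2 v hvfam
  by_contra! hcon
  have huopt : IsOptimal p y N (n + 1) u :=
    ⟨hufam, fun d hd => by have := hb.2 d hd; linarith⟩
  have hvopt : IsOptimal p y N (n + 1) v :=
    ⟨hvfam, fun d hd => by have := hb.2 d hd; linarith⟩
  have huv := huopt.unique hy hvopt
  -- From `a i ⊓ c (i + 1) = c i < c (i + 1)` follows `a i = c i`, hence `v (i + 1) = c (i + 1)`. At
  -- the end `u n = c (n + 1)` contradicts `v n = c n`.
  have key : ∀ i, i ≤ n → v i = c i := by
    intro i
    induction i with
    | zero => exact fun _ => rfl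
    | succ i ih =>
      intro hi
      have h3 := ih (by omega)
      rw [← huv i (by omega), hu1 i hi] at h3
      ext l
      have h4 := congrFun h3 l
      have h5 := hc.1.lt i (by omega) l
      simp only [Pi.inf_apply] at h4
      show max (a i l) (c (i + 1) l) = c (i + 1) l
      omega
  have h3 := (huv n (by omega)).trans (key n le_rfl)
  rw [hu2] at h3
  have h4 := hc.1.lt n (by omega) 0
  rw [h3] at h4
  exact h4.false

theorem cost_nonneg (hp : 2 ≤ p) (E : ZMod f → ℤ) : 0 ≤ cost p y N E :=
  Finset.sum_nonneg fun k _ => mul_nonneg (by positivity) (digitOf_nonneg _ _)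

theorem IsFamily.exists_isOptimal (hp : 2 ≤ p) {n : ℕ} {a : ℕ → ZMod f → ℤ}
    (ha : IsFamily p y N n a) : ∃ b, IsOptimal p y N n (b : ℕ → ZMod f → ℤ) := by
  have hnn : ∀ b : ℕ → ZMod f → ℤ, 0 ≤ familyCost p y N n b := fun b =>
    Finset.sum_nonneg fun i _ => cost_nonneg hp _
  obtain ⟨b, hb, hmin⟩ := exists_minimalFor_of_wellFoundedLT
    (fun b : ℕ → ZMod f → ℤ => IsFamily p y N n b) (fun b => (familyCost p y N n b).toNat) ⟨a, ha⟩
  refine ⟨b, hb, fun c hc => ?_⟩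
  have h1 := hnn b
  have h2 := hnn c
  by_contra! hlt
  have := hmin hc (by dsimp only; omega)
  dsimp only at this
  omega

end Optimal

/-! ### Base `p` digits of natural numbers. -/

section Digits

/-- The `j`-th digit of `k` in base `p`. -/
def dig (p k j : ℕ) : ℕ := k / p ^ j % p

theorem sum_dig {p k N : ℕ} (h : k < p ^ N) : ∑ j ∈ Finset.range N, p ^ j * dig p k j = k := by
  have : ∀ M, ∑ j ∈ Finset.range M, p ^ j * dig p k j = k % p ^ M := by
    intro M
    induction M with
    | zero => simp [Nat.mod_one]
    | succ M ih => rw [Finset.sum_range_succ, ih, Nat.mod_pow_succ, dig]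
  rw [this, Nat.mod_eq_of_lt h]

theorem dig_sum {p N : ℕ} (hp : 0 < p) {d : ℕ → ℕ} (hd : ∀ j, d j < p) (j : ℕ) :
    dig p (∑ i ∈ Finset.range N, p ^ i * d i) j = if j < N then d j else 0 := by
  induction N generalizing d j with
  | zero => simp [dig]
  | succ N ih =>
    have e : ∑ i ∈ Finset.range (N + 1), p ^ i * d i =
        d 0 + p * ∑ i ∈ Finset.range N, p ^ i * d (i + 1) := by
      rw [Finset.sum_range_succ', Finset.mul_sum, add_comm]
      simp only [pow_succ', pow_zero, one_mul, mul_assoc]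
    rw [e]
    obtain _ | j := j
    · simp [dig, Nat.mod_eq_of_lt (hd 0)]
    · have h2 := ih (d := fun i => d (i + 1)) (fun i => hd _) j
      unfold dig at h2 ⊢
      rw [pow_succ', ← Nat.div_div_eq_div_mul, Nat.add_mul_div_left _ _ hp,
        Nat.div_eq_of_lt (hd 0), zero_add, h2]
      simp

theorem dig_eq_zero {p k N j : ℕ} (h : k < p ^ N) (hp : 0 < p) (hj : N ≤ j) : dig p k j = 0 := by
  rw [dig, Nat.div_eq_of_lt (h.trans_le (Nat.pow_le_pow_right hp hj)), Nat.zero_mod]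

theorem sum_dig_int {p k N : ℕ} (h : k < p ^ N) :
    ∑ j ∈ Finset.range N, (p : ℤ) ^ j * (dig p k j : ℤ) = k := by
  conv_rhs => rw [← sum_dig h]
  push_cast
  rfl

theorem isDigits_dig {p k N : ℕ} (hp : 2 ≤ p) (h : k < p ^ N) :
    IsDigits (p : ℤ) N fun j => (dig p k j : ℤ) :=
  ⟨by exact_mod_cast hp, fun _ => by positivity, fun j => by
    have : dig p k j < p := Nat.mod_lt _ (by omega)
    omega, fun j hj => by rw [dig_eq_zero h (by omega) hj]; rfl⟩

end Digits

/-! ### Divisibility by `p ^ f - 1` through class digit sums. -/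

section Carry

variable {f : ℕ} {p : ℤ} {y : ℕ → ℤ} {N : ℕ}

theorem pow_sub_pow_dvd {a b : ℕ} (h : (a : ZMod f) = b) : p ^ f - 1 ∣ p ^ a - p ^ b := by
  rw [ZMod.natCast_eq_natCast_iff] at h
  wlog hab : a ≤ b generalizing a b
  · rw [dvd_sub_comm]
    exact this h.symm (le_of_not_ge hab)
  obtain ⟨c, hc⟩ := (Nat.modEq_iff_dvd' hab).1 h
  obtain rfl : b = a + f * c := by omega
  rw [dvd_sub_comm, pow_add, pow_mul]
  have h1 : p ^ f - 1 ∣ (p ^ f) ^ c - 1 := by simpa using sub_dvd_pow_sub_pow (p ^ f) 1 c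
  have h2 : p ^ a * (p ^ f) ^ c - p ^ a = p ^ a * ((p ^ f) ^ c - 1) := by ring
  rw [h2]
  exact h1.mul_left _

/-- The cyclic rotations of a sequence of digits, reduced modulo `p ^ f - 1`. -/
def rotate (p : ℤ) (N : ℕ) (e : ℕ → ℤ) (l : ZMod f) : ℤ :=
  ∑ j ∈ Finset.range N, e j * p ^ ((j : ZMod f) - l).val

theorem pow_val_sub_one [NeZero f] (x : ZMod f) :
    p * p ^ (x - 1).val - p ^ x.val = if x = 0 then p ^ f - 1 else 0 := by
  obtain ⟨n, rfl⟩ : ∃ n, f = n + 1 := Nat.exists_eq_succ_of_ne_zero (NeZero.ne f)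
  split_ifs with h
  · subst h
    rw [zero_sub, ZMod.val_neg_one, ZMod.val_zero, pow_zero, ← pow_succ']
  · obtain _ | n := n
    · exact absurd (Subsingleton.elim (α := ZMod 1) x 0) h
    · have : Fact (1 < n + 1 + 1) := ⟨by omega⟩
      have h0 : x.val ≠ 0 := fun h0 => h ((ZMod.val_eq_zero x).1 h0)
      rw [ZMod.val_sub (by rw [ZMod.val_one]; omega), ZMod.val_one, ← pow_succ',
        Nat.sub_add_cancel (by omega), sub_self]

/-- Passing from `l` to `l + 1` lowers every exponent by one, except in the class `l`, where it
wraps from `0` to `f - 1` and leaves `p ^ f - 1`. -/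
theorem digitSum_rotate [NeZero f] (e : ℕ → ℤ) (l : ZMod f) :
    digitSum p (rotate p N e) l =
      (p ^ f - 1) * ∑ j ∈ Finset.range N, if (j : ZMod f) = l then e j else 0 := by
  unfold digitSum rotate
  rw [Finset.mul_sum, Finset.mul_sum, ← Finset.sum_sub_distrib]
  refine Finset.sum_congr rfl fun j _ => ?_
  have h := pow_val_sub_one (p := p) ((j : ZMod f) - l)
  simp only [sub_eq_zero, sub_sub] at h
  have : p * (e j * p ^ ((j : ZMod f) - (l + 1)).val) - e j * p ^ ((j : ZMod f) - l).val =
      e j * (p * p ^ ((j : ZMod f) - (l + 1)).val - p ^ ((j : ZMod f) - l).val) := by ring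
  rw [this, h]
  split_ifs <;> ring

/-- Modulo `p ^ f - 1` a rotation multiplied by `p ^ l.val` is the number itself, and `p` is
invertible. -/
theorem dvd_rotate [NeZero f] {e : ℕ → ℤ}
    (h : p ^ f - 1 ∣ ∑ j ∈ Finset.range N, p ^ j * e j) (l : ZMod f) :
    p ^ f - 1 ∣ rotate p N e l := by
  have hco : IsCoprime (p ^ f - 1) p := by
    refine ⟨-1, p ^ (f - 1), ?_⟩
    rw [← pow_succ, Nat.sub_add_cancel (NeZero.pos f)]
    ring
  refine (hco.pow_right (n := l.val)).dvd_of_dvd_mul_right ?_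
  have h2 : p ^ f - 1 ∣ rotate p N e l * p ^ l.val - ∑ j ∈ Finset.range N, p ^ j * e j := by
    unfold rotate
    rw [Finset.sum_mul, ← Finset.sum_sub_distrib]
    refine Finset.dvd_sum fun j _ => ?_
    have h3 : p ^ f - 1 ∣ p ^ (((j : ZMod f) - l).val + l.val) - p ^ j :=
      pow_sub_pow_dvd (by push_cast; rw [ZMod.natCast_zmod_val, ZMod.natCast_zmod_val]; ring)
    have : e j * p ^ ((j : ZMod f) - l).val * p ^ l.val - p ^ j * e j =
        e j * (p ^ (((j : ZMod f) - l).val + l.val) - p ^ j) := by ring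
    rw [this]
    exact h3.mul_left _
  exact (dvd_iff_dvd_of_dvd_sub h2).2 h

/-- Modulo `p ^ f - 1` the cost is `∑ p ^ l.val * digitSum p E l`, which telescopes round the cycle.
-/
theorem dvd_cost [NeZero f] (hy : IsDigits p N y) {E : ZMod f → ℤ} (hE : Feasible p y N E) :
    p ^ f - 1 ∣ cost p y N E := by
  have h1 : ∑ k ∈ Finset.range N, p ^ (k : ZMod f).val * digitOf p y E k =
      ∑ l : ZMod f, p ^ l.val * digitSum p E l := by
    have : ∀ l : ZMod f, p ^ l.val * digitSum p E l = ∑ k ∈ Finset.range N,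
        if (k : ZMod f) = l then p ^ (k : ZMod f).val * digitOf p y E k else 0 := by
      intro l
      conv_lhs => rw [← sum_fill hy l (hE l).1 (hE l).2, Finset.mul_sum]
      refine Finset.sum_congr rfl fun k _ => ?_
      split_ifs with h
      · subst h; rfl
      · simp
    simp only [this]
    rw [Finset.sum_comm]
    simp
  have h2 : p ^ f - 1 ∣ ∑ l : ZMod f, p ^ l.val * digitSum p E l := by
    have e1 : ∑ l : ZMod f, p ^ (l + 1).val * E (l + 1) = ∑ l : ZMod f, p ^ l.val * E l :=
        Equiv.sum_comp (Equiv.addRight (1 : ZMod f)) fun l => p ^ l.val * E l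
    have e2 : ∑ l : ZMod f, p ^ l.val * digitSum p E l =
        ∑ l : ZMod f, (p ^ (l.val + 1) - p ^ (l + 1).val) * E (l + 1) := by
      simp only [digitSum, mul_sub, sub_mul, Finset.sum_sub_distrib, e1]
      simp only [pow_succ, mul_assoc]
    rw [e2]
    exact Finset.dvd_sum fun l _ => (pow_sub_pow_dvd (by push_cast; simp)).mul_right _
  have h3 : p ^ f - 1 ∣ cost p y N E -
      ∑ k ∈ Finset.range N, p ^ (k : ZMod f).val * digitOf p y E k := by
    unfold cost
    rw [← Finset.sum_sub_distrib]
    refine Finset.dvd_sum fun k _ => ?_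
    rw [← sub_mul]
    exact (pow_sub_pow_dvd (by simp)).mul_right _
  rw [h1] at h3
  exact (dvd_iff_dvd_of_dvd_sub h3).2 h2

/-- If `e` were below the greedy expansion at their highest difference `K`, it would be nowhere
above it in the class of `K`, as the greedy digits are full below `K`; the class sums would then
differ. -/
theorem cost_le_of_digits (hy : IsDigits p N y) {E : ZMod f → ℤ} {e : ℕ → ℤ}
    (h0 : ∀ j, 0 ≤ e j) (hey : ∀ j, e j ≤ y j) (hE : Feasible p y N E)
    (h : ∀ l : ZMod f, digitSum p E l = ∑ j ∈ Finset.range N, if (j : ZMod f) = l then e j else 0) :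
    cost p y N E ≤ ∑ j ∈ Finset.range N, p ^ j * e j := by
  by_cases hne : ∃ k < N, e k - digitOf p y E k ≠ 0
  · obtain ⟨K, hK, hKne, htop⟩ := exists_top hne
    have hpos : 1 ≤ e K - digitOf p y E K := by
      by_contra! hlt
      have hlt' : e K < digitOf p y E K := by omega
      have h1 : ∀ j, j ≤ K → (j : ZMod f) = K → e j ≤ digitOf p y E j := fun j hj hjK => by
        rcases hj.eq_or_lt with rfl | hj
        · exact hlt'.le
        -- The left side is `0`: with `cumDigit f y K` units nothing reaches the digit `K`.
        · have h2 : fill f y K (cumDigit f y K) < fill f y K (digitSum p E (K : ZMod f)) := by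
            refine lt_of_le_of_lt ?_ ((h0 K).trans_lt hlt')
            unfold fill
            omega
          have h3 := fill_eq_of_lt hy h2 hj hjK
          unfold digitOf
          rw [hjK, h3]
          exact hey j
      have h4 := (h K).symm.trans (sum_fill hy (K : ZMod f) (hE K).1 (hE K).2).symm
      refine h4.not_lt (Finset.sum_lt_sum (fun j hj => ?_) ⟨K, Finset.mem_range.2 hK, ?_⟩)
      · split_ifs with hjK
        · by_cases hj' : j ≤ K
          · have := h1 j hj' hjK
            unfold digitOf at this
            rwa [hjK] at this
          · have := htop j (by omega) (Finset.mem_range.1 hj)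
            unfold digitOf at this
            rw [hjK] at this
            omega
        · exact le_rfl
      · rw [if_pos rfl, if_pos rfl]; exact hlt'
    have := sum_pos_of_top hy.two_le hK htop hpos fun k => by
      have := h0 k
      have := digitOf_le hy E k
      have := hy.le k
      omega
    simp only [mul_sub, Finset.sum_sub_distrib] at this
    unfold cost
    linarith
  · push Not at hne
    refine (Finset.sum_congr rfl fun k hk => ?_).le
    have := hne k (Finset.mem_range.1 hk)
    congr 1
    omega

end Carry

/-! ### Chains of exponents and their translation into families. -/

/-- `t` is smaller than `k`, digitwise in base `p`, and congruent to it modulo `q - 1`. -/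
structure Step (p q k t : ℕ) : Prop where
  lt : t < k
  dvd : q - 1 ∣ k - t
  dig_le : ∀ j, dig p t j ≤ dig p k j

/-- `n` successive steps down from `k`. -/
structure IsChain (p q k n : ℕ) (t : ℕ → ℕ) : Prop where
  zero : t 0 = k
  step : ∀ i < n, Step p q (t i) (t (i + 1))

/-- The sum of the members of a chain after the first one. -/
def chainSum (n : ℕ) (t : ℕ → ℕ) : ℕ := ∑ i ∈ Finset.range n, t (i + 1)

/-- A chain with maximal sum. -/
structure IsMaxChain (p q k n : ℕ) (t : ℕ → ℕ) : Prop extends IsChain p q k n t where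
  max : ∀ s, IsChain p q k n s → chainSum n s ≤ chainSum n t

section Chain

variable {f p k n N : ℕ} {t : ℕ → ℕ}

theorem IsChain.antitone {q : ℕ} (ht : IsChain p q k n t) {i j : ℕ} (h : i ≤ j) (hj : j ≤ n) :
    t j ≤ t i ∧ ∀ l, dig p (t j) l ≤ dig p (t i) l := by
  induction j, h using Nat.le_induction with
  | base => exact ⟨le_rfl, fun _ => le_rfl⟩
  | succ j h ih =>
    obtain ⟨h1, h2⟩ := ih (by omega)
    have h3 := ht.step j (by omega)
    exact ⟨h3.lt.le.trans h1, fun l => (h3.dig_le l).trans (h2 l)⟩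

theorem IsChain.dvd {q : ℕ} (ht : IsChain p q k n t) {j : ℕ} (hj : j ≤ n) : q - 1 ∣ k - t j := by
  induction j with
  | zero => rw [ht.zero, Nat.sub_self]; exact dvd_zero _
  | succ j ih =>
    have h3 := ht.step j (by omega)
    have h4 := (ht.antitone (Nat.zero_le j) (by omega)).1
    rw [ht.zero] at h4
    have h5 := h3.lt
    have : k - t (j + 1) = (k - t j) + (t j - t (j + 1)) := by omega
    rw [this]
    exact (ih (by omega)).add h3.dvd

theorem IsChain.le {q : ℕ} (ht : IsChain p q k n t) {j : ℕ} (hj : j ≤ n) : t j ≤ k :=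
  ht.zero ▸ (ht.antitone (Nat.zero_le j) hj).1

theorem IsChain.chainSum_le {q : ℕ} (ht : IsChain p q k n t) : chainSum n t ≤ n * k := by
  have := Finset.sum_le_card_nsmul (Finset.range n) (fun i => t (i + 1)) k fun i hi =>
    ht.le (Finset.mem_range.1 hi)
  simpa [chainSum] using this

theorem IsChain.mono {q m : ℕ} (ht : IsChain p q k n t) (h : m ≤ n) : IsChain p q k m t :=
  ⟨ht.zero, fun i hi => ht.step i (by omega)⟩

theorem IsChain.tail {q : ℕ} (ht : IsChain p q k (n + 1) t) :
    IsChain p q (t 1) n fun i => t (i + 1) :=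
  ⟨rfl, fun i hi => ht.step (i + 1) (by omega)⟩

theorem Step.cons {q s : ℕ} (h : Step p q k s) (ht : IsChain p q s n t) :
    IsChain p q k (n + 1) fun i => Nat.casesOn i k t := by
  refine ⟨rfl, fun i hi => ?_⟩
  obtain _ | i := i
  · show Step p q k (t 0)
    rw [ht.zero]; exact h
  · exact ht.step i (by omega)

theorem chainSum_succ (n : ℕ) (t : ℕ → ℕ) :
    chainSum (n + 1) t = chainSum n (fun i => t (i + 1)) + t 1 := by
  rw [chainSum, Finset.sum_range_succ']
  rfl

theorem IsChain.exists_isMaxChain {q : ℕ} (ht : IsChain p q k n t) :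
    ∃ s, IsMaxChain p q k n s := by
  obtain ⟨s, hs, hmin⟩ := exists_minimalFor_of_wellFoundedLT
    (fun s : ℕ → ℕ => IsChain p q k n s) (fun s => n * k - chainSum n s) ⟨t, ht⟩
  refine ⟨s, hs, fun r hr => ?_⟩
  have h1 := hs.chainSum_le
  have h2 := hr.chainSum_le
  by_contra! hlt
  have := hmin hr (by dsimp only; omega)
  dsimp only at this
  omega

theorem IsMaxChain.tail {q : ℕ} (ht : IsMaxChain p q k (n + 1) t) :
    IsMaxChain p q (t 1) n fun i => t (i + 1) := by
  refine ⟨ht.toIsChain.tail, fun s hs => ?_⟩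
  have h1 := ht.step 0 (by omega)
  rw [ht.zero] at h1
  have h2 := ht.max _ (h1.cons hs)
  rw [chainSum_succ, chainSum_succ] at h2
  have h3 : chainSum n s + s 0 ≤ chainSum n (fun i => t (i + 1)) + t 1 := h2
  rw [hs.zero] at h3
  omega

/-- The subtraction `k - t (i + 1)` is digitwise without borrows, and its rotations divided by `p ^
f - 1` form the vector. Costs are only bounded above, since the digits need not be greedy. -/
theorem IsChain.exists_isFamily [NeZero f] (hp : 2 ≤ p) (hk : k < p ^ N)
    (ht : IsChain p (p ^ f) k n t) :
    ∃ a : ℕ → ZMod f → ℤ, IsFamily p (fun j => (dig p k j : ℤ)) N n a ∧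
      ∀ i < n, cost p (fun j => (dig p k j : ℤ)) N (a i) ≤ k - t (i + 1) := by
  have hy := isDigits_dig hp hk
  have hq : 0 < (p : ℤ) ^ f - 1 := by
    have : 1 < (p : ℤ) ^ f := one_lt_pow₀ (by exact_mod_cast hp) (NeZero.ne f)
    omega
  set e : ℕ → ℕ → ℤ := fun i j => (dig p k j : ℤ) - dig p (t (i + 1)) j with he
  have hle : ∀ i < n, ∀ j, dig p (t (i + 1)) j ≤ dig p k j := fun i hi j => by
    have := (ht.antitone (Nat.zero_le (i + 1)) hi).2 j
    rwa [ht.zero] at this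
  have he0 : ∀ i < n, ∀ j, 0 ≤ e i j := fun i hi j => by
    have := hle i hi j
    simp only [he]; omega
  have hey : ∀ i j, e i j ≤ dig p k j := fun i j => by
    simp only [he]; omega
  have hsum : ∀ i < n, ∑ j ∈ Finset.range N, (p : ℤ) ^ j * e i j = k - t (i + 1) := fun i hi => by
    simp only [he, mul_sub, Finset.sum_sub_distrib]
    rw [sum_dig_int hk, sum_dig_int ((ht.le hi).trans_lt hk)]
  have hdvd : ∀ i < n, ∀ l : ZMod f, (p : ℤ) ^ f - 1 ∣ rotate p N (e i) l := fun i hi =>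
    dvd_rotate (by
      rw [hsum i hi]
      have h1 := Int.natCast_dvd_natCast.2 (ht.dvd (j := i + 1) hi)
      rw [Nat.cast_sub (ht.le (j := i + 1) hi), Nat.cast_sub (Nat.one_le_pow _ _ (by omega))] at h1
      exact_mod_cast h1)
  set a : ℕ → ZMod f → ℤ := fun i l => rotate p N (e i) l / ((p : ℤ) ^ f - 1) with ha
  have hmul : ∀ i < n, ∀ l, ((p : ℤ) ^ f - 1) * a i l = rotate p N (e i) l := fun i hi l =>
    Int.mul_ediv_cancel' (hdvd i hi l)
  have hds : ∀ i < n, ∀ l : ZMod f, digitSum p (a i) l =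
      ∑ j ∈ Finset.range N, if (j : ZMod f) = l then e i j else 0 := fun i hi l => by
    apply mul_left_cancel₀ hq.ne'
    rw [← digitSum_rotate]
    unfold digitSum
    rw [← hmul i hi, ← hmul i hi]
    ring
  have hfeas : ∀ i < n, Feasible p (fun j => (dig p k j : ℤ)) N (a i) := fun i hi l => by
    rw [hds i hi l]
    constructor
    · exact Finset.sum_nonneg fun j _ => by
        split_ifs
        · exact he0 i hi j
        · exact le_rfl
    · exact Finset.sum_le_sum fun j _ => by
        split_ifs
        · exact hey i j
        · exact le_rfl
  have hrot : ∀ (u v : ℕ → ℤ), (∀ j, u j ≤ v j) →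
      ∑ j ∈ Finset.range N, (p : ℤ) ^ j * u j < ∑ j ∈ Finset.range N, (p : ℤ) ^ j * v j →
      ∀ l : ZMod f, rotate p N u l < rotate p N v l := fun u v huv hlt l => by
    obtain ⟨j, hj, hj'⟩ := Finset.exists_lt_of_sum_lt hlt
    have h1 : ∀ m : ℕ, (0 : ℤ) < (p : ℤ) ^ m := fun m => by positivity
    exact Finset.sum_lt_sum (fun i _ => mul_le_mul_of_nonneg_right (huv i) (h1 _).le)
      ⟨j, hj, mul_lt_mul_of_pos_right (lt_of_mul_lt_mul_left hj' (h1 _).le) (h1 _)⟩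
  refine ⟨a, ⟨hfeas, fun i hi l => ?_, fun i hi l => ?_⟩, fun i hi => ?_⟩
  · have h1 := hrot (fun _ => 0) (e i) (he0 i hi) (by
      rw [hsum i hi]
      have h2 := (ht.step 0 (by omega)).lt
      have h3 := (ht.antitone (i := 1) (j := i + 1) (by omega) hi).1
      rw [ht.zero, zero_add] at h2
      simp only [mul_zero, Finset.sum_const_zero]
      omega) l
    rw [← hmul i hi] at h1
    have h0 : rotate p N (fun _ => (0 : ℤ)) l = 0 := by simp [rotate]
    rw [h0] at h1
    exact (mul_pos_iff_of_pos_left hq).1 h1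
  · have h1 := hrot (e i) (e (i + 1)) (fun j => by
      have := (ht.step (i + 1) hi).dig_le j
      simp only [he]; omega) (by
      rw [hsum i (by omega), hsum (i + 1) hi]
      have := (ht.step (i + 1) hi).lt
      omega) l
    rw [← hmul i (by omega), ← hmul (i + 1) hi] at h1
    exact lt_of_mul_lt_mul_left h1 hq.le
  · rw [← hsum i hi]
    exact cost_le_of_digits hy (he0 i hi) (hey i) (hfeas i hi) (hds i hi)

/-- The greedy digits are subtracted from those of `k`. Optimality enters through
`IsOptimal.digitSum_mono`, without which the numbers need not decrease digitwise. -/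
theorem IsOptimal.exists_isChain [NeZero f] (hp : 2 ≤ p) (hk : k < p ^ N)
    {a : ℕ → ZMod f → ℤ} (ha : IsOptimal p (fun j => (dig p k j : ℤ)) N n a) :
    ∃ t, IsChain p (p ^ f) k n t ∧
      ∀ i < n, cost p (fun j => (dig p k j : ℤ)) N (a i) = k - t (i + 1) := by
  have hy := isDigits_dig hp hk
  have hp1 : (1 : ℤ) < p := by exact_mod_cast hp
  set y : ℕ → ℤ := fun j => (dig p k j : ℤ) with hyy
  set d : ℕ → ℕ → ℕ := fun i j => (y j - digitOf p y (a i) j).toNat with hd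
  have hdc : ∀ i j, (d i j : ℤ) = y j - digitOf p y (a i) j := fun i j => by
    have := digitOf_le hy (a i) j
    simp only [hd]; omega
  have hdy : ∀ i j, d i j ≤ dig p k j := fun i j => by
    have := hdc i j
    have := digitOf_nonneg (p := p) (y := y) (a i) j
    have : y j = dig p k j := rfl
    omega
  set s : ℕ → ℕ := fun i => ∑ j ∈ Finset.range N, p ^ j * d i j with hs
  have hsc : ∀ i, cost p y N (a i) = k - s i := fun i => by
    have h1 : (s i : ℤ) = ∑ j ∈ Finset.range N, (p : ℤ) ^ j * (y j - digitOf p y (a i) j) := by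
      simp only [hs, Nat.cast_sum, Nat.cast_mul, Nat.cast_pow, hdc]
    rw [h1]
    simp only [mul_sub, Finset.sum_sub_distrib]
    rw [sum_dig_int hk]
    unfold cost
    ring
  have hdig : ∀ i j, dig p (s i) j = if j < N then d i j else 0 := fun i j =>
    dig_sum (by omega) (fun j => (hdy i j).trans_lt (Nat.mod_lt _ (by omega))) j
  have hne : ∀ i < n, 0 < cost p y N (a i) := fun i hi => by
    by_contra! hcon
    have h0 : cost p y N (a i) = 0 := le_antisymm hcon (cost_nonneg hy.two_le _)
    have hz : Feasible p y N (0 : ZMod f → ℤ) := fun l => by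
      have := ha.1.feas i hi l
      simp only [digitSum, Pi.zero_apply]
      omega
    have hz0 : cost p y N (0 : ZMod f → ℤ) = 0 := by
      refine Finset.sum_eq_zero fun j _ => ?_
      have : digitOf p y (0 : ZMod f → ℤ) j = 0 := by
        have h1 : 0 ≤ cumDigit f y j := Finset.sum_nonneg fun i _ => by
          split_ifs
          · exact hy.nonneg i
          · exact le_rfl
        simp only [digitOf, digitSum, Pi.zero_apply, fill]
        omega
      rw [this, mul_zero]
    have := ha.1.pos i hi 0
    rw [eq_of_cost_eq hy (ha.1.feas i hi) hz (h0.trans hz0.symm)] at this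
    exact this.false
  have hdvd : ∀ i < n, (p : ℤ) ^ f - 1 ∣ k - s i := fun i hi => by
    rw [← hsc]; exact dvd_cost hy (ha.1.feas i hi)
  have hcast : ((p ^ f - 1 : ℕ) : ℤ) = (p : ℤ) ^ f - 1 := by
    rw [Nat.cast_sub (Nat.one_le_pow _ _ (by omega))]; push_cast; ring
  refine ⟨fun i => Nat.casesOn i k s, ⟨rfl, fun i hi => ?_⟩, fun i _ => hsc i⟩
  obtain _ | i := i
  · have h1 := hne 0 hi
    rw [hsc] at h1
    have hlt : s 0 < k := by omega
    refine ⟨hlt, ?_, fun j => ?_⟩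
    · show p ^ f - 1 ∣ k - s 0
      rw [← Int.natCast_dvd_natCast, hcast, Nat.cast_sub hlt.le]
      exact hdvd 0 hi
    · show dig p (s 0) j ≤ dig p k j
      rw [hdig]
      split_ifs
      · exact hdy 0 j
      · exact Nat.zero_le _
  · have hmono : ∀ j, digitOf p y (a i) j ≤ digitOf p y (a (i + 1)) j := fun j =>
      fill_mono j (ha.digitSum_mono hy hi _)
    have hlt : s (i + 1) < s i := by
      have h1 : cost p y N (a i) ≤ cost p y N (a (i + 1)) :=
        Finset.sum_le_sum fun j _ => mul_le_mul_of_nonneg_left (hmono j) (by positivity)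
      have h2 : cost p y N (a i) ≠ cost p y N (a (i + 1)) := fun h => by
        have h3 := ha.1.lt i hi 0
        rw [eq_of_cost_eq hy (ha.1.feas i (by omega)) (ha.1.feas _ hi) h] at h3
        exact h3.false
      rw [hsc, hsc] at h1 h2
      omega
    refine ⟨hlt, ?_, fun j => ?_⟩
    · show p ^ f - 1 ∣ s i - s (i + 1)
      rw [← Int.natCast_dvd_natCast, hcast, Nat.cast_sub hlt.le]
      have := (hdvd (i + 1) hi).sub (hdvd i (by omega))
      rwa [sub_sub_sub_cancel_left] at this
    · show dig p (s (i + 1)) j ≤ dig p (s i) j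
      rw [hdig, hdig]
      split_ifs
      · have := hmono j
        have := hdc i j
        have := hdc (i + 1) j
        omega
      · exact le_rfl

theorem sum_sub_chainSum (k n : ℕ) (t : ℕ → ℕ) :
    ∑ i ∈ Finset.range n, ((k : ℤ) - t (i + 1)) = n * k - chainSum n t := by
  simp [chainSum, Finset.sum_sub_distrib]

/-- A chain of maximal sum comes from the optimal family. -/
theorem IsMaxChain.exists_isOptimal [NeZero f] (hp : 2 ≤ p) (hk : k < p ^ N)
    (ht : IsMaxChain p (p ^ f) k n t) :
    ∃ a : ℕ → ZMod f → ℤ, IsOptimal p (fun j => (dig p k j : ℤ)) N n a ∧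
      (∀ i < n, cost p (fun j => (dig p k j : ℤ)) N (a i) = k - t (i + 1)) ∧
      familyCost p (fun j => (dig p k j : ℤ)) N n a = n * k - chainSum n t := by
  obtain ⟨b, hb, hbt⟩ := ht.toIsChain.exists_isFamily hp hk
  obtain ⟨a, ha⟩ := hb.exists_isOptimal (by exact_mod_cast hp)
  obtain ⟨s, hs, has⟩ := ha.exists_isChain hp hk
  have h1 := ha.2 b hb
  have h2 : familyCost p (fun j => (dig p k j : ℤ)) N n a = n * k - chainSum n s := by
    rw [← sum_sub_chainSum]
    exact Finset.sum_congr rfl fun i hi => has i (Finset.mem_range.1 hi)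
  have h3 : familyCost p (fun j => (dig p k j : ℤ)) N n b ≤ n * k - chainSum n t := by
    rw [← sum_sub_chainSum]
    exact Finset.sum_le_sum fun i hi => hbt i (Finset.mem_range.1 hi)
  -- The cost of `b` lies between the optimum `n k - chainSum n s` and `n k - chainSum n t`, so
  -- maximality of `t` closes the circle.
  have h4 := ht.max s hs
  have h5 : familyCost p (fun j => (dig p k j : ℤ)) N n b = n * k - chainSum n t := by omega
  refine ⟨b, ⟨hb, fun c hc => by have := ha.2 c hc; omega⟩, fun i hi => ?_, h5⟩
  rw [← sum_sub_chainSum] at h5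
  exact (Finset.sum_eq_sum_iff_of_le fun i hi => hbt i (Finset.mem_range.1 hi)).1 h5 i
    (Finset.mem_range.2 hi)

theorem IsMaxChain.unique [NeZero f] (hp : 2 ≤ p) {s : ℕ → ℕ}
    (ht : IsMaxChain p (p ^ f) k n t) (hs : IsMaxChain p (p ^ f) k n s) :
    ∀ i ≤ n, t i = s i := by
  have hk : k < p ^ k := Nat.lt_pow_self (by omega)
  obtain ⟨a, ha, hat, -⟩ := ht.exists_isOptimal hp hk
  obtain ⟨b, hb, hbs, -⟩ := hs.exists_isOptimal hp hk
  intro i hi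
  obtain _ | i := i
  · rw [ht.zero, hs.zero]
  · have h1 := hat i hi
    rw [ha.unique (isDigits_dig hp hk) hb i hi, hbs i hi] at h1
    omega

theorem IsMaxChain.add_lt_two_mul [NeZero f] (hp : 2 ≤ p) {s r : ℕ → ℕ}
    (ht : IsMaxChain p (p ^ f) k n t) (hs : IsMaxChain p (p ^ f) k (n + 1) s)
    (hr : IsMaxChain p (p ^ f) k (n + 2) r) :
    chainSum n t + chainSum (n + 2) r < 2 * chainSum (n + 1) s := by
  have hk : k < p ^ k := Nat.lt_pow_self (by omega)
  obtain ⟨a, ha, -, hat⟩ := ht.exists_isOptimal hp hk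
  obtain ⟨b, hb, -, hbs⟩ := hs.exists_isOptimal hp hk
  obtain ⟨c, hc, -, hcr⟩ := hr.exists_isOptimal hp hk
  have h := ha.two_mul_lt (isDigits_dig hp hk) hb hc
  rw [hat, hbs, hcr] at h
  push_cast at h
  zify
  linarith

end Chain

/-! ### Degrees of power sums of monic polynomials. -/

section PowerSum

open Polynomial Nat

variable (F : Type*) [Field F] [Fintype F]

open scoped Classical in
/-- The monic polynomials of degree `n`. -/
noncomputable def monics : ℕ → Finset F[X]
  | 0 => {1}
  | n + 1 => (monics n ×ˢ (Finset.univ : Finset F)).image fun x => X * x.1 + C x.2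

variable {F}

theorem mem_monics {n : ℕ} {f : F[X]} : f ∈ monics F n ↔ f.Monic ∧ f.natDegree = n := by
  classical
  induction n generalizing f with
  | zero =>
    rw [monics, Finset.mem_singleton]
    exact ⟨by rintro rfl; simp, fun h => h.1.natDegree_eq_zero.1 h.2⟩
  | succ n ih =>
    rw [monics, Finset.mem_image]
    constructor
    · rintro ⟨⟨g, c⟩, hg, rfl⟩
      obtain ⟨h1, h2⟩ := ih.1 (Finset.mem_product.1 hg).1
      have h3 : (X * g).natDegree = n + 1 := by
        rw [natDegree_X_mul h1.ne_zero, h2]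
      refine ⟨(monic_X.mul h1).add_of_left ?_, by rw [natDegree_add_C, h3]⟩
      refine degree_C_le.trans_lt (natDegree_pos_iff_degree_pos.1 ?_)
      show 0 < (X * g).natDegree
      omega
    · rintro ⟨h1, h2⟩
      refine ⟨(f.divX, f.coeff 0), Finset.mem_product.2 ⟨ih.2 ⟨?_, ?_⟩, Finset.mem_univ _⟩,
        X_mul_divX_add f⟩
      · rw [Monic, leadingCoeff, natDegree_divX_eq_natDegree_tsub_one, coeff_divX, h2,
          Nat.add_sub_cancel, ← h2]
        exact h1
      · rw [natDegree_divX_eq_natDegree_tsub_one, h2, Nat.add_sub_cancel]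

/-- The sum of the `k`-th powers of the monic polynomials of degree `n`. -/
noncomputable def powerSum (F : Type*) [Field F] [Fintype F] (n k : ℕ) : F[X] :=
  ∑ f ∈ monics F n, f ^ k

theorem powerSum_succ (n k : ℕ) :
    powerSum F (n + 1) k = ∑ t ∈ Finset.range (k + 1),
      X ^ t * powerSum F n t * C ((∑ c : F, c ^ (k - t)) * (k.choose t : F)) := by
  classical
  unfold powerSum
  rw [monics, Finset.sum_image, Finset.sum_product]
  · simp only [add_pow, map_mul, map_sum, Finset.mul_sum, Finset.sum_mul, map_pow, map_natCast]
    rw [Finset.sum_congr rfl fun g _ => Finset.sum_comm, Finset.sum_comm]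
    refine Finset.sum_congr rfl fun t _ => ?_
    rw [Finset.sum_comm]
    refine Finset.sum_congr rfl fun c _ => Finset.sum_congr rfl fun g _ => ?_
    ring
  · rintro ⟨g, c⟩ - ⟨g', c'⟩ - h
    dsimp only at h
    have h2 := congrArg (fun f => coeff f 0) h
    simp only [coeff_add, coeff_X_mul_zero, coeff_C_zero, zero_add] at h2
    rw [h2, add_left_inj] at h
    rw [h2, mul_left_cancel₀ X_ne_zero h]

theorem sum_pow_eq (i : ℕ) :
    ∑ c : F, c ^ i = if 0 < i ∧ Fintype.card F - 1 ∣ i then -1 else 0 := by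
  classical
  obtain _ | i := i
  · simp
  · have h : ∑ c : F, c ^ (i + 1) = ∑ c : Fˣ, (c : F) ^ (i + 1) := by
      refine Eq.trans ?_
        (Finset.sum_map Finset.univ ⟨Units.val, Units.val_injective⟩ fun c : F => c ^ (i + 1))
      refine (Finset.sum_subset (Finset.subset_univ _) fun c _ hc => ?_).symm
      have : c = 0 := by
        by_contra h0
        exact hc (Finset.mem_map.2 ⟨Units.mk0 c h0, Finset.mem_univ _, rfl⟩)
      rw [this, zero_pow (Nat.succ_ne_zero i)]
    rw [h, FiniteField.sum_pow_units]
    simp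

/-- Lucas: the binomial is the product of those of the digits, and for digits below `p` these are
divisible by `p` only when they vanish. -/
theorem choose_ne_zero_iff {F : Type*} [Field F] (p : ℕ) [Fact p.Prime] [CharP F p] (k t : ℕ) :
    (k.choose t : F) ≠ 0 ↔ ∀ j, dig p t j ≤ dig p k j := by
  have hp : p.Prime := Fact.out
  have h1 : k < p ^ (k + t) := (Nat.lt_pow_self hp.one_lt).trans_le
    (Nat.pow_le_pow_right hp.pos (by omega))
  have h2 : t < p ^ (k + t) := (Nat.lt_pow_self hp.one_lt).trans_le
    (Nat.pow_le_pow_right hp.pos (by omega))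
  have h := Choose.choose_modEq_prod_range_choose_nat (p := p) h1 h2
  rw [Ne, CharP.cast_eq_zero_iff F p, (h.dvd_iff dvd_rfl), hp.prime.dvd_finsetProd_iff]
  push Not
  constructor
  · intro h j
    by_cases hj : j < k + t
    · by_contra! hlt
      refine h j (Finset.mem_range.2 hj) ?_
      unfold dig at hlt
      rw [Nat.choose_eq_zero_of_lt hlt]
      exact dvd_zero _
    · rw [dig_eq_zero h2 hp.pos (not_lt.1 hj)]
      exact Nat.zero_le _
  · intro h j _ hd
    have h3 : dig p k j < p := Nat.mod_lt _ hp.pos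
    have h4 := hd.mul_right ((dig p t j)! * (dig p k j - dig p t j)!)
    rw [← mul_assoc] at h4
    change p ∣ (dig p k j).choose (dig p t j) * _ * _ at h4
    rw [Nat.choose_mul_factorial_mul_factorial (h j), hp.dvd_factorial] at h4
    omega

theorem step_iff (p : ℕ) [Fact p.Prime] [CharP F p] {k t : ℕ} (h : t ≤ k) :
    (∑ c : F, c ^ (k - t)) * (k.choose t : F) ≠ 0 ↔ Step p (Fintype.card F) k t := by
  rw [mul_ne_zero_iff, choose_ne_zero_iff p, sum_pow_eq]
  constructor
  · rintro ⟨h1, h2⟩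
    have h3 : 0 < k - t ∧ Fintype.card F - 1 ∣ k - t := by
      by_contra hcon
      exact h1 (if_neg hcon)
    exact ⟨by omega, h3.2, h2⟩
  · rintro ⟨h1, h2, h3⟩
    rw [if_pos ⟨by omega, h2⟩]
    exact ⟨neg_ne_zero.2 one_ne_zero, h3⟩

/-- The degrees of the power sums are the maximal sums of chains. -/
theorem powerSum_cases (p : ℕ) [Fact p.Prime] [CharP F p] (n k : ℕ) :
    (∃ t, IsMaxChain p (Fintype.card F) k n t ∧ powerSum F n k ≠ 0 ∧
      (powerSum F n k).natDegree = chainSum n t) ∨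
    ((¬ ∃ t, IsChain p (Fintype.card F) k n t) ∧ powerSum F n k = 0) := by
  have hp : p.Prime := Fact.out
  obtain ⟨f, -, hcard⟩ := FiniteField.card F p
  have : NeZero (f : ℕ) := ⟨f.pos.ne'⟩
  rw [hcard]
  have hstep : ∀ {k t : ℕ}, t ≤ k →
      ((∑ c : F, c ^ (k - t)) * (k.choose t : F) ≠ 0 ↔ Step p (p ^ (f : ℕ)) k t) := fun h => by
    rw [← hcard]; exact step_iff p h
  induction n generalizing k with
  | zero =>
    refine Or.inl ⟨fun _ => k, ⟨⟨rfl, fun i hi => absurd hi (Nat.not_lt_zero i)⟩, fun s _ => ?_⟩, ?_⟩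
    · simp [chainSum]
    · simp [powerSum, monics, chainSum]
  | succ n ih =>
    by_cases hch : ∃ t, IsChain p (p ^ (f : ℕ)) k (n + 1) t
    · left
      obtain ⟨s, hs⟩ := hch
      obtain ⟨t, ht⟩ := hs.exists_isMaxChain
      refine ⟨t, ht, ?_⟩
      have hst := ht.step 0 (Nat.succ_pos n)
      rw [ht.zero, zero_add] at hst
      set M := chainSum (n + 1) t with hM
      set T : ℕ → F[X] := fun t => X ^ t * powerSum F n t *
        C ((∑ c : F, c ^ (k - t)) * (k.choose t : F)) with hT
      have hdeg1 : (T (t 1)).degree = M := by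
        obtain ⟨r, hr, h1, h2⟩ | ⟨h1, -⟩ := ih (t 1)
        · have h3 : chainSum n r = chainSum n (fun i => t (i + 1)) :=
            le_antisymm (ht.tail.max r hr.toIsChain) (hr.max _ ht.tail.toIsChain)
          rw [hT]
          dsimp only
          rw [degree_mul_C ((hstep hst.lt.le).2 hst), degree_mul, degree_X_pow,
            degree_eq_natDegree h1, h2, h3, hM, chainSum_succ, add_comm]
          push_cast
          rfl
        · exact absurd ⟨_, ht.tail.toIsChain⟩ h1
      -- Another term of degree `M` would yield a second maximal chain, with first step `s ≠ t 1`.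
      -- So the top term cannot cancel.
      have hdeg2 : ∀ s ∈ (Finset.range (k + 1)).erase (t 1), T s ∈ degreeLT F M := by
        intro s hs
        rw [Finset.mem_erase, Finset.mem_range] at hs
        by_cases h0 : (∑ c : F, c ^ (k - s)) * (k.choose s : F) = 0
        · have : T s = 0 := by simp only [hT, h0, map_zero, mul_zero]
          rw [this]
          exact Submodule.zero_mem _
        have hss := (hstep (by omega)).1 h0
        obtain ⟨r, hr, h1, h2⟩ | ⟨-, h1⟩ := ih s
        · rw [mem_degreeLT, hT]
          dsimp only
          rw [degree_mul_C h0, degree_mul, degree_X_pow, degree_eq_natDegree h1, h2]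
          have h3 := hss.cons hr.toIsChain
          have h4 := ht.max _ h3
          have h5 : chainSum (n + 1) (fun i => Nat.casesOn i k r) = chainSum n r + s := by
            rw [chainSum_succ]
            exact congrArg (chainSum n r + ·) hr.zero
          rw [h5] at h4
          have h6 : chainSum n r + s ≠ M := fun h => by
            have h7 : IsMaxChain p (p ^ (f : ℕ)) k (n + 1) fun i => Nat.casesOn i k r :=
              ⟨h3, fun u hu => by rw [h5, h]; exact ht.max u hu⟩
            have h8 := ht.unique hp.two_le h7 1 (by omega)
            exact hs.1 (hr.zero.symm.trans h8.symm)
          have h9 : s + chainSum n r < M := by omega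
          exact_mod_cast h9
        · have : T s = 0 := by simp only [hT, h1, mul_zero, zero_mul]
          rw [this]
          exact Submodule.zero_mem _
      have hsum : powerSum F (n + 1) k =
          T (t 1) + ∑ s ∈ (Finset.range (k + 1)).erase (t 1), T s := by
        rw [powerSum_succ, Finset.add_sum_erase _ _ (Finset.mem_range.2 (by have := hst.lt; omega))]
      have hdeg : (powerSum F (n + 1) k).degree = M := by
        rw [hsum, degree_add_eq_left_of_degree_lt, hdeg1]
        rw [hdeg1]
        exact mem_degreeLT.1 (Submodule.sum_mem _ hdeg2)
      exact ⟨fun h => by rw [h, degree_zero] at hdeg; exact absurd hdeg (by simp),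
        natDegree_eq_of_degree_eq_some hdeg⟩
    · right
      refine ⟨hch, ?_⟩
      rw [powerSum_succ]
      refine Finset.sum_eq_zero fun s hs => ?_
      rw [Finset.mem_range] at hs
      by_cases h0 : (∑ c : F, c ^ (k - s)) * (k.choose s : F) = 0
      · rw [h0, map_zero, mul_zero]
      · have hss := (hstep (by omega)).1 h0
        obtain ⟨r, hr, -⟩ | ⟨-, h1⟩ := ih s
        · exact absurd ⟨_, hss.cons hr.toIsChain⟩ hch
        · rw [h1, mul_zero, zero_mul]

end PowerSum

/-! ### Monotonicity, convexity and divisibility for degrees. -/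

section Degrees

variable {F : Type*} [Field F] [Fintype F]

/-- Dropping the last member of a chain loses at most `k`; so the valuations `n k - deg S_n(k)` do
not decrease with `n`. -/
theorem powerSum_ne_zero_of_succ (p : ℕ) [Fact p.Prime] [CharP F p] {n k : ℕ}
    (h : powerSum F (n + 1) k ≠ 0) : powerSum F n k ≠ 0 ∧
      (powerSum F (n + 1) k).natDegree ≤ (powerSum F n k).natDegree + k := by
  obtain ⟨t, ht, -, h1⟩ | ⟨-, h1⟩ := powerSum_cases (F := F) p (n + 1) k
  · obtain ⟨s, hs, h2, h3⟩ | ⟨h2, -⟩ := powerSum_cases (F := F) p n k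
    · refine ⟨h2, ?_⟩
      have h4 := hs.max t (ht.toIsChain.mono (Nat.le_succ n))
      have h5 := ht.toIsChain.le (le_refl (n + 1))
      rw [h1, h3, chainSum, Finset.sum_range_succ]
      exact add_le_add h4 h5
    · exact absurd ⟨t, ht.toIsChain.mono (Nat.le_succ n)⟩ h2
  · exact absurd h1 h

theorem natDegree_powerSum_add_lt (p : ℕ) [Fact p.Prime] [CharP F p] {n k : ℕ}
    (h : powerSum F (n + 2) k ≠ 0) :
    (powerSum F n k).natDegree + (powerSum F (n + 2) k).natDegree <
      2 * (powerSum F (n + 1) k).natDegree := by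
  have h' := (powerSum_ne_zero_of_succ p h).1
  have h'' := (powerSum_ne_zero_of_succ p h').1
  obtain ⟨t, ht, -, h1⟩ := (powerSum_cases p (n + 2) k).resolve_right fun h1 => h h1.2
  obtain ⟨s, hs, -, h2⟩ := (powerSum_cases p (n + 1) k).resolve_right fun h1 => h' h1.2
  obtain ⟨r, hr, -, h3⟩ := (powerSum_cases p n k).resolve_right fun h1 => h'' h1.2
  obtain ⟨f, -, hcard⟩ := FiniteField.card F p
  have : NeZero (f : ℕ) := ⟨f.pos.ne'⟩
  rw [hcard] at ht hs hr
  rw [h1, h2, h3]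
  exact hr.add_lt_two_mul (Fact.out : p.Prime).two_le hs ht

theorem dvd_natDegree_powerSum (p : ℕ) [Fact p.Prime] [CharP F p] {n k : ℕ}
    (h : powerSum F n k ≠ 0) :
    (Fintype.card F : ℤ) - 1 ∣ n * k - (powerSum F n k).natDegree := by
  obtain ⟨t, ht, -, h1⟩ := (powerSum_cases p n k).resolve_right fun h1 => h h1.2
  rw [h1, ← sum_sub_chainSum]
  refine Finset.dvd_sum fun i hi => ?_
  rw [Finset.mem_range] at hi
  have h2 := Int.natCast_dvd_natCast.2 (ht.toIsChain.dvd (j := i + 1) hi)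
  rw [Nat.cast_sub (ht.toIsChain.le (j := i + 1) hi), Nat.cast_sub Fintype.card_pos] at h2
  exact_mod_cast h2

end Degrees

/-! ### `1`-units of ideals. -/

section OneUnit

open Polynomial WithZero Filter Topology

variable {F : Type*} [Field F]

theorem IsOneUnit.mul {u u' : KInfty F} (hu : IsOneUnit u) (hu' : IsOneUnit u') :
    IsOneUnit (u * u') := by
  have : u * u' - 1 = u * (u' - 1) + (u - 1) := by ring
  rw [IsOneUnit, this]
  refine Valuation.map_add_lt _ ?_ hu
  rw [map_mul, hu.v_eq, one_mul]
  exact hu'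

theorem IsOneUnitPart.mul {π α β u u' : KInfty F} (hπ : IsUniformizer π)
    (h : IsOneUnitPart π α u) (h' : IsOneUnitPart π β u') : IsOneUnitPart π (α * β) (u * u') := by
  obtain ⟨hu, ζ, ⟨m, hm, hζ⟩, k, rfl⟩ := h
  obtain ⟨hu', ζ', ⟨m', hm', hζ'⟩, k', rfl⟩ := h'
  have hπ0 : π ≠ 0 := by
    rintro rfl
    rw [IsUniformizer, map_zero] at hπ
    exact exp_ne_zero hπ.symm
  refine ⟨hu.mul hu', ζ * ζ', ⟨m * m', Nat.mul_pos hm hm', ?_⟩, k + k', ?_⟩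
  · rw [mul_pow, pow_mul, hζ, one_pow, mul_comm m, pow_mul, hζ', one_pow, one_mul]
  · rw [zpow_add₀ hπ0]; ring

theorem IsOneUnit.isOneUnitPart (π : KInfty F) {u : KInfty F} (hu : IsOneUnit u) :
    IsOneUnitPart π u u :=
  ⟨hu, 1, ⟨1, one_pos, one_pow 1⟩, 0, by simp⟩

theorem isOneUnit_one : IsOneUnit (1 : KInfty F) := by
  rw [IsOneUnit, sub_self, map_zero]
  exact zero_lt_one

theorem IsOneUnitPart.pow {π α u : KInfty F} (hπ : IsUniformizer π)
    (h : IsOneUnitPart π α u) (n : ℕ) : IsOneUnitPart π (α ^ n) (u ^ n) := by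
  induction n with
  | zero => simpa using isOneUnit_one.isOneUnitPart π
  | succ n ih => rw [pow_succ, pow_succ]; exact ih.mul hπ h

/-- The embedding of the polynomials into `K_∞`. -/
noncomputable def polyEmb (F : Type*) [Field F] : F[X] →+* KInfty F :=
  (algebraMap (RatFunc F) (KInfty F)).comp (algebraMap F[X] (RatFunc F))

theorem v_polyEmb {f : F[X]} (hf : f ≠ 0) :
    (Valued.v (polyEmb F f) : ℤᵐ⁰) = exp (f.natDegree : ℤ) := v_poly hf

theorem polyEmb_ne_zero {f : F[X]} (hf : f ≠ 0) : polyEmb F f ≠ 0 := fun h => by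
  have := v_polyEmb hf
  rw [h, map_zero] at this
  exact exp_ne_zero this.symm

theorem isOneUnitPart_C [Fintype F] (π : KInfty F) {c : F} (hc : c ≠ 0) :
    IsOneUnitPart π (polyEmb F (C c)) 1 := by
  refine ⟨isOneUnit_one, polyEmb F (C c), ⟨Fintype.card F - 1, ?_, ?_⟩, 0, by simp⟩
  · have := Fintype.one_lt_card (α := F); omega
  · rw [← map_pow, ← C_pow, FiniteField.pow_card_sub_one_eq_one c hc, C_1, map_one]

theorem isOneUnit_div {n : ℕ} {f : F[X]} (hf : f.Monic) (hn : f.natDegree = n) :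
    IsOneUnit (polyEmb F f / polyEmb F X ^ n) := by
  have hX : polyEmb F X ^ n ≠ 0 := pow_ne_zero _ (polyEmb_ne_zero X_ne_zero)
  have e : polyEmb F f / polyEmb F X ^ n - 1 = polyEmb F (f - X ^ n) / polyEmb F X ^ n := by
    rw [div_sub_one hX, map_sub, map_pow]
  rw [IsOneUnit, e]
  by_cases h : f - X ^ n = 0
  · rw [h, map_zero, zero_div, map_zero]
    exact zero_lt_one
  · have hdeg : (f - X ^ n).degree < f.degree := by
      refine degree_sub_lt_left ?_ hf.ne_zero ?_
      · rw [degree_X_pow, degree_eq_natDegree hf.ne_zero, hn]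
      · rw [hf.leadingCoeff, (monic_X_pow n).leadingCoeff]
    have := natDegree_lt_natDegree h hdeg
    rw [map_div₀, map_pow, v_polyEmb h, v_polyEmb X_ne_zero, natDegree_X, ← exp_nsmul, ← exp_sub,
      ← exp_zero, exp_lt_exp]
    simp only [Nat.cast_one, nsmul_eq_mul, mul_one]
    omega

/-- `f` is `X ^ n` times a `1`-unit, and passing to another generator only introduces a constant,
which is a root of unity. -/
theorem idealOneUnit_span (p : ℕ) [Fact p.Prime] [CharP F p] [Fintype F] {π : KInfty F}
    (hπ : IsUniformizer π) {w : KInfty F} (hw : IsOneUnitPart π (polyEmb F X) w) {n : ℕ}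
    {f : F[X]} (hf : f.Monic) (hn : f.natDegree = n) :
    idealOneUnit π (Ideal.span {f}) = w ^ n * (polyEmb F f / polyEmb F X ^ n) := by
  set g := Submodule.IsPrincipal.generator (Ideal.span {f}) with hg
  have hgf : Associated f g := Ideal.span_singleton_eq_span_singleton.1
    (Ideal.span_singleton_generator (Ideal.span {f})).symm
  obtain ⟨u, hu⟩ := hgf
  obtain ⟨c, hc, hcu⟩ := isUnit_iff.1 u.isUnit
  have hX : polyEmb F X ^ n ≠ 0 := pow_ne_zero _ (polyEmb_ne_zero X_ne_zero)
  have h1 : IsOneUnitPart π (polyEmb F g) (w ^ n * (polyEmb F f / polyEmb F X ^ n)) := by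
    have h2 := (((hw.pow hπ n).mul hπ ((isOneUnit_div hf hn).isOneUnitPart π)).mul hπ
      (isOneUnitPart_C π hc.ne_zero))
    rw [mul_one, mul_div_cancel₀ _ hX, ← map_mul, hcu, hu] at h2
    exact h2
  have hg0 : g ≠ 0 := by
    rw [← hu]; exact mul_ne_zero hf.ne_zero u.ne_zero
  have h2 : ∃ v, IsOneUnitPart π (polyEmb F g) v := ⟨_, h1⟩
  have h3 : idealOneUnit π (Ideal.span {f}) = h2.choose := dif_pos h2
  rw [h3]
  exact (existsUnique_oneUnitPart p hπ (polyEmb_ne_zero hg0)).unique h2.choose_spec h1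

theorem eventually_v_eq {α : Type*} {l : Filter α} {x : α → KInfty F} {c : KInfty F}
    (h : Tendsto x l (𝓝 c)) (hc : c ≠ 0) :
    ∀ᶠ N in l, (Valued.v (x N) : ℤᵐ⁰) = Valued.v c :=
  h (Valued.locally_const ((Valuation.ne_zero_iff _).2 hc))

theorem eventually_v_lt {α : Type*} {l : Filter α} {x : α → KInfty F} {c : KInfty F}
    (h : Tendsto x l (𝓝 0)) (hc : c ≠ 0) :
    ∀ᶠ N in l, (Valued.v (x N) : ℤᵐ⁰) < Valued.v c := by
  suffices {z : KInfty F | (Valued.v z : ℤᵐ⁰) < Valued.v c} ∈ 𝓝 0 from h this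
  rw [Valued.mem_nhds]
  have h' : (Valued.v (R := KInfty F) (Γ₀ := ℤᵐ⁰)).restrict c ≠ 0 := by simpa using hc
  refine ⟨Units.mk0 _ h', fun z hz => ?_⟩
  rw [Units.val_mk0] at hz
  have := Valuation.restrict_lt_iff _ |>.1 hz
  rwa [sub_zero] at this

end OneUnit

/-! ### Coefficients at `p`-adic exponents as limits. -/

section Zeta

open Polynomial WithZero Filter Topology

variable {F : Type*} [Field F] [Fintype F]

theorem coeff_zeta {p : ℕ} [Fact p.Prime] (π : KInfty F) (y : ℤ_[p]) (n : ℕ) :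
    PowerSeries.coeff n (zeta π y) =
      ∑ f ∈ monics F n, padicPow (idealOneUnit π (Ideal.span {f})) y := by
  rw [zeta, PowerSeries.coeff_mk, idealsOfDegree_eq, finsum_mem_image, ← finsum_mem_coe_finset]
  · congr! 3 with f
    rw [Finset.mem_coe, mem_monics]
    rfl
  · rintro f hf g hg h
    exact eq_of_monic_of_associated hf.1 hg.1 (Ideal.span_singleton_eq_span_singleton.1 h)

/-- The coefficient of `x ^ n` in `ζ(x, k)` for a natural number `k`. -/
noncomputable def natCoeff (π : KInfty F) (n k : ℕ) : KInfty F :=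
  ∑ f ∈ monics F n, idealOneUnit π (Ideal.span {f}) ^ k

theorem natCoeff_eq (p : ℕ) [Fact p.Prime] [CharP F p] {π : KInfty F} (hπ : IsUniformizer π)
    {w : KInfty F} (hw : IsOneUnitPart π (polyEmb F X) w) (n k : ℕ) :
    natCoeff π n k = (w ^ n / polyEmb F X ^ n) ^ k * polyEmb F (powerSum F n k) := by
  rw [powerSum, map_sum, Finset.mul_sum]
  refine Finset.sum_congr rfl fun f hf => ?_
  obtain ⟨h1, h2⟩ := mem_monics.1 hf
  rw [idealOneUnit_span p hπ hw h1 h2, map_pow, ← mul_pow]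
  ring

theorem v_natCoeff (p : ℕ) [Fact p.Prime] [CharP F p] {π : KInfty F} (hπ : IsUniformizer π)
    {n k : ℕ} (h : powerSum F n k ≠ 0) :
    (Valued.v (natCoeff π n k) : ℤᵐ⁰) = exp ((powerSum F n k).natDegree - n * k : ℤ) := by
  obtain ⟨w, hw, -⟩ := existsUnique_oneUnitPart p hπ (polyEmb_ne_zero (F := F) X_ne_zero)
  rw [natCoeff_eq p hπ hw, map_mul, v_polyEmb h, map_pow, map_div₀, map_pow, map_pow, hw.1.v_eq,
    v_polyEmb X_ne_zero, natDegree_X, one_pow, ← exp_nsmul, one_div, ← exp_neg, ← exp_nsmul,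
    ← exp_add]
  congr 1
  simp
  ring

theorem natCoeff_eq_zero (p : ℕ) [Fact p.Prime] [CharP F p] {π : KInfty F}
    (hπ : IsUniformizer π) {n k : ℕ} (h : powerSum F n k = 0) : natCoeff π n k = 0 := by
  obtain ⟨w, hw, -⟩ := existsUnique_oneUnitPart p hπ (polyEmb_ne_zero (F := F) X_ne_zero)
  rw [natCoeff_eq p hπ hw, h, map_zero, mul_zero]

theorem tendsto_natCoeff {p : ℕ} [Fact p.Prime] [CharP F p] {π : KInfty F}
    (hπ : IsUniformizer π) (y : ℤ_[p]) (n : ℕ) :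
    Tendsto (fun N => natCoeff π n (y.appr N)) atTop (𝓝 (PowerSeries.coeff n (zeta π y))) := by
  obtain ⟨w, hw, -⟩ := existsUnique_oneUnitPart p hπ (polyEmb_ne_zero (F := F) X_ne_zero)
  rw [coeff_zeta]
  refine tendsto_finsetSum _ fun f hf => tendsto_padicPow ?_ y
  obtain ⟨h1, h2⟩ := mem_monics.1 hf
  rw [idealOneUnit_span p hπ hw h1 h2]
  exact ((hw.pow hπ n).mul hπ ((isOneUnit_div h1 h2).isOneUnitPart π)).1

theorem eventually_powerSum {p : ℕ} [Fact p.Prime] [CharP F p] {π : KInfty F}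
    (hπ : IsUniformizer π) (y : ℤ_[p]) {n : ℕ} (h : PowerSeries.coeff n (zeta π y) ≠ 0) :
    ∀ᶠ N in atTop, powerSum F n (y.appr N) ≠ 0 ∧
      -log (Valued.v (PowerSeries.coeff n (zeta π y)) : ℤᵐ⁰) =
        n * y.appr N - (powerSum F n (y.appr N)).natDegree := by
  filter_upwards [eventually_v_eq (tendsto_natCoeff hπ y n) h] with N hN
  have h0 : powerSum F n (y.appr N) ≠ 0 := fun h0 => by
    rw [natCoeff_eq_zero p hπ h0, map_zero] at hN
    exact h ((Valuation.zero_iff _).1 hN.symm)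
  refine ⟨h0, ?_⟩
  rw [← hN, v_natCoeff p hπ h0, log_exp]
  ring

theorem coeff_zero_zeta_ne_zero {p : ℕ} [Fact p.Prime] [CharP F p] {π : KInfty F}
    (hπ : IsUniformizer π) (y : ℤ_[p]) : PowerSeries.coeff 0 (zeta π y) ≠ 0 := fun h => by
  have h1 := tendsto_natCoeff hπ y 0
  rw [h] at h1
  obtain ⟨N, hN⟩ := (eventually_v_lt h1 one_ne_zero).exists
  have h2 : powerSum F 0 (y.appr N) = 1 := by simp [powerSum, monics]
  rw [v_natCoeff p hπ (by rw [h2]; exact one_ne_zero), h2] at hN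
  simp at hN

/-- If only the `n`-th coefficient vanished, its approximations would become smaller than the `(n +
1)`-st, against the monotonicity of valuations at natural exponents. -/
theorem coeff_zeta_ne_zero_of_succ {p : ℕ} [Fact p.Prime] [CharP F p] {π : KInfty F}
    (hπ : IsUniformizer π) (y : ℤ_[p]) {n : ℕ}
    (h : PowerSeries.coeff (n + 1) (zeta π y) ≠ 0) : PowerSeries.coeff n (zeta π y) ≠ 0 :=
  fun h0 => by
  have h1 := tendsto_natCoeff hπ y n
  rw [h0] at h1
  obtain ⟨N, hN1, hN2, hN3⟩ := ((eventually_v_lt h1 h).and (eventually_powerSum hπ y h)).exists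
  obtain ⟨h2, h3⟩ := powerSum_ne_zero_of_succ p hN2
  have h4 : (Valued.v (PowerSeries.coeff (n + 1) (zeta π y)) : ℤᵐ⁰) ≠ 0 :=
    (Valuation.ne_zero_iff _).2 h
  rw [v_natCoeff p hπ h2, ← exp_log h4, exp_lt_exp] at hN1
  push_cast at hN3
  zify at h3
  linarith

theorem coeff_zeta_convex {p : ℕ} [Fact p.Prime] [CharP F p] {π : KInfty F}
    (hπ : IsUniformizer π) (y : ℤ_[p]) {n : ℕ}
    (h : PowerSeries.coeff (n + 2) (zeta π y) ≠ 0) :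
    2 * -log (Valued.v (PowerSeries.coeff (n + 1) (zeta π y)) : ℤᵐ⁰) <
      -log (Valued.v (PowerSeries.coeff n (zeta π y)) : ℤᵐ⁰) +
        -log (Valued.v (PowerSeries.coeff (n + 2) (zeta π y)) : ℤᵐ⁰) := by
  have h' := coeff_zeta_ne_zero_of_succ hπ y h
  have h'' := coeff_zeta_ne_zero_of_succ hπ y h'
  obtain ⟨N, ⟨-, h1⟩, ⟨-, h2⟩, h3, h4⟩ := ((eventually_powerSum hπ y h'').and
    ((eventually_powerSum hπ y h').and (eventually_powerSum hπ y h))).exists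
  rw [h1, h2, h4]
  have h5 := natDegree_powerSum_add_lt p h3
  zify at h5
  push_cast
  linarith

theorem dvd_log_coeff_zeta {p : ℕ} [Fact p.Prime] [CharP F p] {π : KInfty F}
    (hπ : IsUniformizer π) (y : ℤ_[p]) {n : ℕ} (h : PowerSeries.coeff n (zeta π y) ≠ 0) :
    (Fintype.card F : ℤ) - 1 ∣ -log (Valued.v (PowerSeries.coeff n (zeta π y)) : ℤᵐ⁰) := by
  obtain ⟨N, h1, h2⟩ := (eventually_powerSum hπ y h).exists
  rw [h2]
  exact dvd_natDegree_powerSum p h1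

end Zeta

/-! ### Newton polygons of strictly convex valuations. -/

section Newton

open PowerSeries WithZero

variable {F : Type*} [Field F] {f : PowerSeries (KInfty F)} {V : ℕ → ℝ}

/-- The coefficients of `f` that do not vanish are those up to some index, and their valuations
`V n` are strictly convex. -/
structure IsStrictlyConvex (f : PowerSeries (KInfty F)) (V : ℕ → ℝ) : Prop where
  ord_eq : ∀ n, coeff n f ≠ 0 → ord (coeff n f) = V n
  zero : coeff 0 f ≠ 0
  pred : ∀ n, coeff (n + 1) f ≠ 0 → coeff n f ≠ 0
  lt : ∀ n, coeff (n + 2) f ≠ 0 → V (n + 1) - V n < V (n + 2) - V (n + 1)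

namespace IsStrictlyConvex

theorem coeff_ne_zero (h : IsStrictlyConvex f V) {m n : ℕ} (hmn : m ≤ n) (hn : coeff n f ≠ 0) :
    coeff m f ≠ 0 := by
  induction n, hmn using Nat.le_induction with
  | base => exact hn
  | succ n _ ih => exact ih (h.pred n hn)

theorem sub_lt_sub (h : IsStrictlyConvex f V) {m n : ℕ} (hmn : m < n)
    (hn : coeff (n + 1) f ≠ 0) : V (m + 1) - V m < V (n + 1) - V n := by
  induction n, hmn using Nat.le_induction with
  | base => exact h.lt m hn
  | succ n _ ih => exact (ih (h.pred _ hn)).trans (h.lt n hn)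

/-- A line through `(n, V n)` whose slope separates the increments before `n` from those after it is
a supporting line. -/
theorem line_le (h : IsStrictlyConvex f V) {n : ℕ} {m : ℝ}
    (h1 : ∀ i < n, V (i + 1) - V i ≤ m)
    (h2 : ∀ i, n ≤ i → coeff (i + 1) f ≠ 0 → m ≤ V (i + 1) - V i) (k : ℕ) :
    ((m * k + (V n - m * n) : ℝ) : EReal) ≤ ord (coeff k f) := by
  by_cases hk : coeff k f = 0
  · rw [hk, ord, if_pos rfl]; exact le_top
  rw [h.ord_eq k hk, EReal.coe_le_coe_iff]
  rcases le_total n k with hnk | hkn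
  · induction k, hnk using Nat.le_induction with
    | base => linarith
    | succ k hnk ih =>
      have := ih (h.pred k hk)
      have := h2 k hnk hk
      push_cast
      linarith
  · have key : ∀ j, j ≤ n → V n ≤ V j + m * (n - j) := fun j hj => by
      induction hj using Nat.decreasingInduction with
      | self => simp
      | of_succ i hi ih =>
        have := h1 i hi
        push_cast at ih
        linarith
    have := key k hkn
    linarith

theorem le_newtonPolygon (h : IsStrictlyConvex f V) {n : ℕ} {m : ℝ}
    (h1 : ∀ i < n, V (i + 1) - V i ≤ m)
    (h2 : ∀ i, n ≤ i → coeff (i + 1) f ≠ 0 → m ≤ V (i + 1) - V i) (k : ℕ) :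
    ((m * k + (V n - m * n) : ℝ) : EReal) ≤ newtonPolygon f k :=
  le_iSup₂_of_le (m, V n - m * n) (h.line_le h1 h2) le_rfl

theorem newtonPolygon_eq (h : IsStrictlyConvex f V) {n : ℕ} (hn : coeff n f ≠ 0) :
    newtonPolygon f n = V n := by
  refine le_antisymm (iSup₂_le fun l hl => (hl n).trans (h.ord_eq n hn).le) ?_
  have : ∃ m : ℝ, (∀ i < n, V (i + 1) - V i ≤ m) ∧
      ∀ i, n ≤ i → coeff (i + 1) f ≠ 0 → m ≤ V (i + 1) - V i := by
    by_cases hn1 : coeff (n + 1) f = 0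
    -- There are no later increments, so any bound for the earlier ones is a valid slope.
    · exact ⟨∑ i ∈ Finset.range n, |V (i + 1) - V i|, fun i hi => (le_abs_self _).trans
        (Finset.single_le_sum (f := fun i => |V (i + 1) - V i|) (fun i _ => abs_nonneg _)
          (Finset.mem_range.2 hi)),
        fun i hi hi1 => absurd hn1 (h.coeff_ne_zero (by omega) hi1)⟩
    · refine ⟨V (n + 1) - V n, fun i hi => (h.sub_lt_sub hi hn1).le, fun i hi hi1 => ?_⟩
      rcases hi.eq_or_lt with rfl | hi
      · exact le_rfl
      · exact (h.sub_lt_sub hi hi1).le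
  obtain ⟨m, h1, h2⟩ := this
  refine le_trans (le_of_eq ?_) (h.le_newtonPolygon h1 h2 n)
  congr 1
  ring

/-- Supporting lines through the last finite point may be arbitrarily steep. -/
theorem newtonPolygon_ne_coe (h : IsStrictlyConvex f V) {n : ℕ} (hn : coeff n f = 0) (a : ℝ) :
    newtonPolygon f n ≠ a := by
  classical
  intro ha
  have hex : ∃ n, coeff n f = 0 := ⟨n, hn⟩
  obtain ⟨l, hl⟩ : ∃ l, Nat.find hex = l + 1 := Nat.exists_eq_succ_of_ne_zero fun h0 =>
    h.zero (h0 ▸ Nat.find_spec hex)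
  have hl1 : coeff (l + 1) f = 0 := hl ▸ Nat.find_spec hex
  have hln : l + 1 ≤ n := hl ▸ Nat.find_min' hex hn
  set S := ∑ i ∈ Finset.range l, |V (i + 1) - V i| with hS
  have hS0 : 0 ≤ S := Finset.sum_nonneg fun i _ => abs_nonneg _
  -- With slope at least `a - V l + 1`, the line through `(l, V l)` already exceeds `a` at `l + 1 ≤
  -- n`.
  have h1 := h.le_newtonPolygon (n := l) (m := max S (a - V l + 1))
    (fun i hi => ((le_abs_self _).trans (Finset.single_le_sum (f := fun i => |V (i + 1) - V i|)
      (fun i _ => abs_nonneg _) (Finset.mem_range.2 hi))).trans (le_max_left _ _))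
    (fun i hi hi1 => absurd hl1 (h.coeff_ne_zero (by omega) hi1)) n
  rw [ha, EReal.coe_le_coe_iff] at h1
  have h2 := le_max_left S (a - V l + 1)
  have h3 := le_max_right S (a - V l + 1)
  have h4 : ((l + 1 : ℕ) : ℝ) ≤ n := by exact_mod_cast hln
  push_cast at h4
  nlinarith

theorem slopeMultiplicity_eq_one (h : IsStrictlyConvex f V) {s : ℝ} (hs : IsSlope f s) :
    slopeMultiplicity f s = 1 ∧ ∃ n, coeff (n + 1) f ≠ 0 ∧ s = V (n + 1) - V n := by
  have key : ∀ n, (∃ a : ℝ, newtonPolygon f n = (a : EReal) ∧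
      newtonPolygon f (n + 1) = ((a + s : ℝ) : EReal)) →
      coeff (n + 1) f ≠ 0 ∧ s = V (n + 1) - V n := by
    rintro n ⟨a, h1, h2⟩
    have hn : coeff (n + 1) f ≠ 0 := fun hn => h.newtonPolygon_ne_coe hn _ h2
    refine ⟨hn, ?_⟩
    rw [h.newtonPolygon_eq hn, EReal.coe_eq_coe_iff] at h2
    rw [h.newtonPolygon_eq (h.pred n hn), EReal.coe_eq_coe_iff] at h1
    linarith
  obtain ⟨n, hn⟩ := Set.encard_ne_zero.1 hs
  obtain ⟨h1, h2⟩ := key n hn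
  refine ⟨Set.encard_eq_one.2 ⟨n, Set.eq_singleton_iff_unique_mem.2 ⟨hn, fun m hm => ?_⟩⟩, n, h1, h2⟩
  obtain ⟨h3, h4⟩ := key m hm
  rcases lt_trichotomy m n with hlt | heq | hlt
  · have := h.sub_lt_sub hlt h1; linarith
  · exact heq
  · have := h.sub_lt_sub hlt h3; linarith

end IsStrictlyConvex

theorem isStrictlyConvex_zeta [Fintype F] {p : ℕ} [Fact p.Prime] [CharP F p] {π : KInfty F}
    (hπ : IsUniformizer π) (y : ℤ_[p]) :
    IsStrictlyConvex (zeta π y) fun n => ((-log (Valued.v (coeff n (zeta π y)) : ℤᵐ⁰) : ℤ) : ℝ) where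
  ord_eq n hn := by rw [ord, if_neg hn]
  zero := coeff_zero_zeta_ne_zero hπ y
  pred n hn := coeff_zeta_ne_zero_of_succ hπ y hn
  lt n hn := by
    have h : ((2 * -log (Valued.v (coeff (n + 1) (zeta π y)) : ℤᵐ⁰) : ℤ) : ℝ) < _ :=
      Int.cast_lt.2 (coeff_zeta_convex hπ y hn)
    push_cast at h ⊢
    linarith

end Newton

end GossZeta

theorem corollaryc {F : Type*} [Field F] [Fintype F] {p : ℕ} [Fact p.Prime] [CharP F p]
    (π : GossZeta.KInfty F) (hπ : GossZeta.IsUniformizer π) (y : ℤ_[p])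
    (s : ℝ) (hs : GossZeta.IsSlope (GossZeta.zeta π y) s) :
    GossZeta.slopeMultiplicity (GossZeta.zeta π y) s = 1 ∧
      ∃ k : ℤ, s = k * ((Fintype.card F : ℝ) - 1) := by
  obtain ⟨h, n, hn, hsn⟩ := (GossZeta.isStrictlyConvex_zeta hπ y).slopeMultiplicity_eq_one hs
  refine ⟨h, ?_⟩
  obtain ⟨k, hk⟩ := (GossZeta.dvd_log_coeff_zeta hπ y hn).sub
    (GossZeta.dvd_log_coeff_zeta hπ y (GossZeta.coeff_zeta_ne_zero_of_succ hπ y hn))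
  refine ⟨k, ?_⟩
  rw [hsn, ← Int.cast_sub, hk]
  push_cast
  ring
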